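/- Let $\mathbb F$ be an algebraically closed field of characteristic zero, and let $\mathcal C$ be an $\mathbb F$-linear semisimple (in particular abelian) rigid braided tensor category with finite-dimensional $\mathrm{Hom}$-spaces and $\mathrm{End}(\mathbf 1)=\mathbb F\,\mathrm{id}_{\mathbf 1}$, with braiding $c$. (Associativity and unit constraints are suppressed in the notation.) Let $G$ be a finite group and let $\mathcal S\subset\mathcal C$ be a full tensor subcategory together with an $\mathbb F$-linear braided equivalence $\Phi:\mathrm{Rep}_{\mathbb F}^{fin}G\to\mathcal S$. Let $\Gamma\in\mathcal S$ be the image under $\Phi$ of the left regular representation $\mathrm{Fun}(G,\mathbb F)$ with basis $(\delta_g)_{g\in G}$, with the structure morphisms $m,\eta,\Delta,\varepsilon$ induced by $m(\delta_g\otimes\delta_h)=\delta_{g,h}\delta_g$, $\eta(1)=\sum_g\delta_g$, $\Delta(\delta_g)=|G|\,\delta_g\otimes\delta_g$, $\varepsilon(\delta_g)=|G|^{-1}$. Let $\mathcal C\rtimes_0\mathcal S$ be the tensor category with the objects of $\mathcal C$ and their tensor products, with $\mathrm{Hom}(X,Y)=\mathrm{Hom}_{\mathcal C}(\Gamma\otimes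 X,Y)$, composition $t\,\tilde\circ\,s=t\circ(\mathrm{id}_\Gamma\otimes s)\circ(\Delta\otimes\mathrm{id}_X)$, and tensor product $s\,\tilde\otimes\,t=(s\otimes t)\circ(\mathrm{id}_\Gamma\otimes c_{\Gamma,X}\otimes\mathrm{id}_Z)\circ(\Delta\otimes\mathrm{id}_X\otimes\mathrm{id}_Z)$ for $s:X\to Y$, $t:Z\to T$. Write $\iota(f)=\varepsilon\otimes f$ for morphisms $f$ of $\mathcal C$. Let $\mathcal C\rtimes\mathcal S$ be the completion of $\mathcal C\rtimes_0\mathcal S$ with respect to splitting idempotents: its objects are the pairs $(X,p)$ with $p=p\,\tilde\circ\,p\in\mathrm{End}_{\mathcal C\rtimes_0\mathcal S}(X)$, and $(X,p)\otimes(Y,q)=(X\otimes Y,p\,\tilde\otimes\,q)$. Let $\mathrm{Aut}(\Gamma)=\mathrm{Aut}(\Gamma,m,\eta)$ be the group of automorphisms of the monoid $(\Gamma,m,\eta)$, with product $gh=g\circ h$. For $g\in\mathrm{Aut}(\Gamma)$ put $\gamma_g(s)=s\circ(g^{-1}\otimes\mathrm{id}_X)$ for $s\in\mathrm{Hom}_{\mathcal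 C}(\Gamma\otimes X,Y)$ and $\gamma_g(X,p)=(X,\gamma_g(p))$. For a simple object $(X,p)$ of $\mathcal C\rtimes\mathcal S$ let $\partial(X,p)=\partial'\circ\Delta\in\mathrm{End}_{\mathcal C}(\Gamma)$, where $\partial'\in\mathrm{End}_{\mathcal C\rtimes_0\mathcal S}(\Gamma)$ is determined by $$\iota\bigl(c_{\Gamma,X}^{-1}\circ c_{X,\Gamma}^{-1}\bigr)\,\tilde\circ\,(\mathrm{id}_\Gamma\,\tilde\otimes\,p)=\partial'\,\tilde\otimes\,p .$$ An object of $\mathcal C\rtimes\mathcal S$ is called homogeneous of grade $g\in\mathrm{Aut}(\Gamma)$ if it is isomorphic to a finite non-empty direct sum of simple objects $X_i$ with $\partial X_i=g$; one then writes $\partial X=g$. Proposition. $\mathrm{Aut}(\Gamma)\cong G$, and with these data $\mathcal C\rtimes\mathcal S$ is a crossed $\mathrm{Aut}(\Gamma)$-category (i.e. a crossed $G$-category). That is: 1. The full subcategory of homogeneous objects contains the unit and is closed under $\otimes$; the grade $\partial X$ of a homogeneous object is well defined and depends only on the isomorphism class of $X$; every object of $\mathcal C\rtimes\mathcal S$ is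 a finite direct sum of homogeneous objects. 2. $g\mapsto\gamma_g$ is a strict action of $\mathrm{Aut}(\Gamma)$ on $\mathcal C\rtimes\mathcal S$ by strict tensor automorphisms: $\gamma_1=\mathrm{id}$, $\gamma_{gh}=\gamma_g\gamma_h$, and each $\gamma_g$ preserves $\otimes$ and the unit on the nose. 3. $\partial(X\otimes Y)=\partial X\,\partial Y$ for all homogeneous $X,Y$. 4. If $X$ is homogeneous of grade $h$, then $\gamma_g(X)$ is homogeneous of grade $ghg^{-1}$. If moreover the tensor category $\mathcal C$ is strict, then so is $\mathcal C\rtimes\mathcal S$. -/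

import Mathlib

open CategoryTheory MonoidalCategory Limits Idempotents

universe w v u

noncomputable section

open scoped ComonObj MonObj TensorProduct

section PreGaloisSection

variable {C : Type u} [Category.{v} C] [MonoidalCategory C]

/-- Objects of the category `C ⋊₀ S`: the same as the objects of `C`.  Here `Γ` is a (cocommutative)
comonoid in `C`. -/
structure PreGalois (Γ : C) where
  /-- the underlying object of `C` -/
  of : C

namespace PreGalois
variable {Γ : C}

/-- `Hom(X, Y)` in `C ⋊₀ S` is `Hom_C(Γ ⊗ X, Y)`. -/
@[ext]
structure Hom (X Y : PreGalois Γ) where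
  /-- the underlying morphism of `C` -/
  hom : Γ ⊗ X.of ⟶ Y.of

variable [ComonObj Γ]

lemma comul_counit_aux (X : C) :
    Δ[Γ] ▷ X ≫ (α_ Γ Γ X).hom ≫ Γ ◁ ε[Γ] ▷ X ≫ Γ ◁ (λ_ X).hom = 𝟙 _ := by
  have h : (Δ[Γ] ≫ Γ ◁ ε[Γ]) ▷ X = (ρ_ Γ).inv ▷ X := by rw [ComonObj.comul_counit]
  rw [comp_whiskerRight] at h
  have h2 : (α_ Γ Γ X).hom ≫ Γ ◁ ε[Γ] ▷ X ≫ Γ ◁ (λ_ X).hom =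
      (Γ ◁ ε[Γ]) ▷ X ≫ (ρ_ Γ).hom ▷ X := by monoidal
  rw [h2, reassoc_of% h, inv_hom_whiskerRight]

lemma counit_comul_aux (X : C) :
    Δ[Γ] ▷ X ≫ (α_ Γ Γ X).hom ≫ ε[Γ] ▷ (Γ ⊗ X) ≫ (λ_ (Γ ⊗ X)).hom = 𝟙 _ := by
  have h : (Δ[Γ] ≫ ε[Γ] ▷ Γ) ▷ X = (λ_ Γ).inv ▷ X := by rw [ComonObj.counit_comul]
  rw [comp_whiskerRight] at h
  have h2 : (α_ Γ Γ X).hom ≫ ε[Γ] ▷ (Γ ⊗ X) ≫ (λ_ (Γ ⊗ X)).hom =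
      ε[Γ] ▷ Γ ▷ X ≫ (λ_ Γ).hom ▷ X := by monoidal
  rw [h2, reassoc_of% h, inv_hom_whiskerRight]

lemma comul_assoc_aux (X : C) :
    Δ[Γ] ▷ X ≫ (α_ Γ Γ X).hom ≫ Γ ◁ Δ[Γ] ▷ X ≫ Γ ◁ (α_ Γ Γ X).hom =
      Δ[Γ] ▷ X ≫ (α_ Γ Γ X).hom ≫ Δ[Γ] ▷ (Γ ⊗ X) ≫ (α_ Γ Γ (Γ ⊗ X)).hom := by
  have h : (Δ[Γ] ≫ Γ ◁ Δ[Γ]) ▷ X = (Δ[Γ] ≫ Δ[Γ] ▷ Γ ≫ (α_ Γ Γ Γ).hom) ▷ X := by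
    rw [ComonObj.comul_assoc]
  simp only [comp_whiskerRight] at h
  have h2 : (α_ Γ Γ X).hom ≫ Γ ◁ Δ[Γ] ▷ X ≫ Γ ◁ (α_ Γ Γ X).hom =
      (Γ ◁ Δ[Γ]) ▷ X ≫ (α_ Γ (Γ ⊗ Γ) X).hom ≫ Γ ◁ (α_ Γ Γ X).hom := by monoidal
  rw [h2, reassoc_of% h]
  monoidal

/-- The composite of `s` and `t` is `t ∘ (id_Γ ⊗ s) ∘ (Δ ⊗ id_X)`, the identity is `ε ⊗ id_X`. -/
instance : Category (PreGalois Γ) where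
  Hom := Hom
  id X := ⟨ε[Γ] ▷ X.of ≫ (λ_ X.of).hom⟩
  comp {X _ _} s t := ⟨Δ[Γ] ▷ X.of ≫ (α_ Γ Γ X.of).hom ≫ Γ ◁ s.hom ≫ t.hom⟩
  id_comp {X Y} s := by
    ext
    dsimp
    rw [whiskerLeft_comp]
    have h := comul_counit_aux (Γ := Γ) X.of
    simp only [Category.assoc]
    rw [reassoc_of% h]
  comp_id {X Y} s := by
    ext
    dsimp
    have h1 : Γ ◁ s.hom ≫ ε[Γ] ▷ Y.of = ε[Γ] ▷ _ ≫ _ ◁ s.hom := whisker_exchange _ _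
    have h := counit_comul_aux (Γ := Γ) X.of
    rw [reassoc_of% h1, leftUnitor_naturality, reassoc_of% h]
  assoc {W X Y Z} s t r := by
    ext
    dsimp
    simp only [whiskerLeft_comp, Category.assoc]
    have h1 : Γ ◁ s.hom ≫ Δ[Γ] ▷ X.of = Δ[Γ] ▷ _ ≫ _ ◁ s.hom := whisker_exchange _ _
    have h := comul_assoc_aux (Γ := Γ) W.of
    rw [reassoc_of% h1, reassoc_of% h]
    simp

@[ext]
lemma hom_ext {X Y : PreGalois Γ} {s t : X ⟶ Y} (h : s.hom = t.hom) : s = t := Hom.ext h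

lemma id_hom (X : PreGalois Γ) : Hom.hom (𝟙 X) = ε[Γ] ▷ X.of ≫ (λ_ X.of).hom := rfl
lemma comp_hom {X Y Z : PreGalois Γ} (s : X ⟶ Y) (t : Y ⟶ Z) :
  Hom.hom (s ≫ t) = Δ[Γ] ▷ X.of ≫ (α_ Γ Γ X.of).hom ≫ Γ ◁ s.hom ≫ t.hom := rfl

/-- The canonical map on morphisms, `f ↦ ε ⊗ f`. -/
def inc {X Y : C} (f : X ⟶ Y) : (⟨X⟩ : PreGalois Γ) ⟶ ⟨Y⟩ :=
  ⟨ε[Γ] ▷ X ≫ (λ_ X).hom ≫ f⟩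

lemma inc_hom {X Y : C} (f : X ⟶ Y) :
    Hom.hom (inc (Γ := Γ) f) = ε[Γ] ▷ X ≫ (λ_ X).hom ≫ f := rfl

lemma inc_comp_hom {X Y : C} (f : X ⟶ Y) {Z : PreGalois Γ} (t : (⟨Y⟩ : PreGalois Γ) ⟶ Z) :
    Hom.hom (inc f ≫ t) = Γ ◁ f ≫ t.hom := by
  have h := comul_counit_aux (Γ := Γ) X
  simp only [comp_hom, inc_hom, whiskerLeft_comp, Category.assoc]
  rw [reassoc_of% h]

lemma comp_inc_hom {X : PreGalois Γ} {Y Z : C} (s : X ⟶ (⟨Y⟩ : PreGalois Γ)) (f : Y ⟶ Z) :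
    Hom.hom (s ≫ inc f) = s.hom ≫ f := by
  have h1 : Γ ◁ s.hom ≫ ε[Γ] ▷ Y = ε[Γ] ▷ _ ≫ _ ◁ s.hom := whisker_exchange _ _
  have h := counit_comul_aux (Γ := Γ) X.of
  simp only [comp_hom, inc_hom]
  rw [reassoc_of% h1, leftUnitor_naturality_assoc, reassoc_of% h]

lemma inc_id (X : C) : inc (Γ := Γ) (𝟙 X) = 𝟙 (⟨X⟩ : PreGalois Γ) := by
  ext; simp [inc_hom, id_hom]

lemma inc_comp {X Y Z : C} (f : X ⟶ Y) (g : Y ⟶ Z) :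
    inc (Γ := Γ) (f ≫ g) = inc f ≫ inc g := by
  ext; simp [comp_inc_hom, inc_hom]

/-- An isomorphism of `C` seen in `PreGalois Γ`. -/
def incIso {X Y : C} (f : X ≅ Y) : (⟨X⟩ : PreGalois Γ) ≅ ⟨Y⟩ where
  hom := inc f.hom
  inv := inc f.inv
  hom_inv_id := by rw [← inc_comp, f.hom_inv_id, inc_id]
  inv_hom_id := by rw [← inc_comp, f.inv_hom_id, inc_id]

section preadd
variable [Preadditive C] [MonoidalPreadditive C]
/-- Morphisms of `C ⋊₀ S` are morphisms of `C`. -/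
def homEquiv (X Y : PreGalois Γ) :
    (X ⟶ Y) ≃ (Γ ⊗ X.of ⟶ Y.of) :=
  ⟨Hom.hom, Hom.mk, fun _ => rfl, fun _ => rfl⟩

instance : Preadditive (PreGalois Γ) where
  homGroup X Y := (homEquiv X Y).addCommGroup
  add_comp X Y Z s s' t := by
    ext
    change _ = Hom.hom (s ≫ t) + Hom.hom (s' ≫ t)
    simp only [comp_hom]
    change Δ[Γ] ▷ X.of ≫ (α_ Γ Γ X.of).hom ≫ Γ ◁ (s.hom + s'.hom) ≫ t.hom = _
    simp
  comp_add X Y Z s t t' := by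
    ext
    change _ = Hom.hom (s ≫ t) + Hom.hom (s ≫ t')
    simp only [comp_hom]
    change Δ[Γ] ▷ X.of ≫ (α_ Γ Γ X.of).hom ≫ Γ ◁ s.hom ≫ (t.hom + t'.hom) = _
    simp
end preadd

section monoidal
variable [BraidedCategory C]

/-- `id_X ⊗ t`; the `Γ`-leg is braided past `X` by `c_{Γ,X}`. -/
def wL (X : PreGalois Γ) {Z T : PreGalois Γ} (t : Z ⟶ T) :
    (⟨X.of ⊗ Z.of⟩ : PreGalois Γ) ⟶ ⟨X.of ⊗ T.of⟩ :=
  ⟨(α_ Γ X.of Z.of).inv ≫ (β_ Γ X.of).hom ▷ Z.of ≫ (α_ _ _ _).hom ≫ X.of ◁ t.hom⟩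

/-- `s ⊗ id_Z`. -/
def wR {X Y : PreGalois Γ} (s : X ⟶ Y) (Z : PreGalois Γ) :
    (⟨X.of ⊗ Z.of⟩ : PreGalois Γ) ⟶ ⟨Y.of ⊗ Z.of⟩ :=
  ⟨(α_ Γ X.of Z.of).inv ≫ s.hom ▷ Z.of⟩

/-- `s ⊗ t`, which is `(s ⊗ t) ∘ (id_Γ ⊗ c_{Γ,X} ⊗ id_Z) ∘ (Δ ⊗ id_X ⊗ id_Z)` in `C`
(up to associativity constraints; `tensorμ` is the interchange built from `c_{Γ,X}`). -/
def tH {X Y Z T : PreGalois Γ} (s : X ⟶ Y) (t : Z ⟶ T) :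
    (⟨X.of ⊗ Z.of⟩ : PreGalois Γ) ⟶ ⟨Y.of ⊗ T.of⟩ :=
  ⟨Δ[Γ] ▷ (X.of ⊗ Z.of) ≫ tensorμ Γ Γ X.of Z.of ≫ (s.hom ⊗ₘ t.hom)⟩


lemma wL_inc (X : PreGalois Γ) {Z T : C} (t : Z ⟶ T) :
    wL X (inc t) = inc (X.of ◁ t) := by
  ext
  have h : (β_ Γ X.of).hom ≫ X.of ◁ ε[Γ] = ε[Γ] ▷ X.of ≫ (β_ (𝟙_ C) X.of).hom :=
    (BraidedCategory.braiding_naturality_left _ _).symm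
  have h2 : (β_ Γ X.of).hom ▷ Z ≫ (α_ _ _ _).hom ≫ X.of ◁ ε[Γ] ▷ Z =
      ((β_ Γ X.of).hom ≫ X.of ◁ ε[Γ]) ▷ Z ≫ (α_ _ _ _).hom := by
    rw [comp_whiskerRight, Category.assoc, associator_naturality_middle]
  simp only [wL, inc_hom, whiskerLeft_comp]
  rw [reassoc_of% h2, h, braiding_tensorUnit_left]
  monoidal

lemma wR_inc {X Y : C} (s : X ⟶ Y) (Z : PreGalois Γ) :
    wR (inc s) Z = inc (s ▷ Z.of) := by
  ext
  simp only [wR, inc_hom]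
  monoidal

lemma wL_comp (X : PreGalois Γ) {Z T U : PreGalois Γ} (t : Z ⟶ T) (t' : T ⟶ U) :
    wL X (t ≫ t') = wL X t ≫ wL X t' := by
  ext
  have h : (β_ Γ X.of).hom ≫ X.of ◁ Δ[Γ] = Δ[Γ] ▷ X.of ≫ (β_ (Γ ⊗ Γ) X.of).hom :=
    (BraidedCategory.braiding_naturality_left _ _).symm
  have h2 : (β_ Γ X.of).hom ▷ Z.of ≫ (α_ _ _ _).hom ≫ X.of ◁ Δ[Γ] ▷ Z.of =
      ((β_ Γ X.of).hom ≫ X.of ◁ Δ[Γ]) ▷ Z.of ≫ (α_ _ _ _).hom := by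
    rw [comp_whiskerRight, Category.assoc, associator_naturality_middle]
  simp only [wL, comp_hom, whiskerLeft_comp, Category.assoc]
  rw [reassoc_of% h2, h, BraidedCategory.braiding_tensor_left_hom]
  have h3 : Γ ◁ X.of ◁ t.hom ≫ (α_ Γ X.of T.of).inv ≫ (β_ Γ X.of).hom ▷ T.of =
    (α_ Γ X.of _).inv ≫ (β_ Γ X.of).hom ▷ _ ≫ _ ◁ t.hom := by
    rw [associator_inv_naturality_right_assoc, whisker_exchange]
  rw [reassoc_of% h3]
  monoidal

lemma wR_comp {X Y Y' : PreGalois Γ} (s : X ⟶ Y) (s' : Y ⟶ Y') (Z : PreGalois Γ) :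
    wR (s ≫ s') Z = wR s Z ≫ wR s' Z := by
  ext
  simp [wR, comp_hom]

lemma exch_aux {X Y Z T : PreGalois Γ} (s : X ⟶ Y) (t : Z ⟶ T) :
    wL X t ≫ wR s T = tH s t := by
  ext
  simp only [wR, wL, tH, tensorμ, comp_hom, tensorHom_def', whiskerLeft_comp, Category.assoc]
  monoidal

lemma tH_def [IsCommComonObj Γ] {X Y Z T : PreGalois Γ} (s : X ⟶ Y) (t : Z ⟶ T) :
    tH s t = wR s Z ≫ wL Y t := by
  ext
  have h1 : Γ ◁ s.hom ≫ (β_ Γ Y.of).hom = (β_ Γ (Γ ⊗ X.of)).hom ≫ s.hom ▷ Γ :=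
    BraidedCategory.braiding_naturality_right _ _
  have h2 : Γ ◁ s.hom ▷ Z.of ≫ (α_ Γ Y.of Z.of).inv ≫ (β_ Γ Y.of).hom ▷ Z.of =
      (α_ Γ (Γ ⊗ X.of) Z.of).inv ≫ (Γ ◁ s.hom ≫ (β_ Γ Y.of).hom) ▷ Z.of := by
    rw [comp_whiskerRight, associator_inv_naturality_middle_assoc]
  have h3 : Δ[Γ] ▷ (X.of ⊗ Z.of) = Δ[Γ] ▷ (X.of ⊗ Z.of) ≫ (β_ Γ Γ).hom ▷ (X.of ⊗ Z.of) := by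
    rw [← comp_whiskerRight, IsCommComonObj.comul_comm]
  simp only [wR, wL, tH, tensorμ, comp_hom, MonoidalCategory.tensorHom_def, Category.assoc,
    whiskerLeft_comp]
  rw [reassoc_of% h2, h1, BraidedCategory.braiding_tensor_right_hom]
  conv_lhs => rw [h3]
  monoidal

lemma nat1 {X Y : PreGalois Γ} (s : X ⟶ Y) (Z T : PreGalois Γ) :
    wR (wR s Z) T ≫ inc (α_ Y.of Z.of T.of).hom =
      inc (α_ X.of Z.of T.of).hom ≫ wR s ⟨Z.of ⊗ T.of⟩ := by
  ext
  rw [comp_inc_hom, inc_comp_hom]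
  simp only [wR]
  monoidal

lemma nat2 (X : PreGalois Γ) {Y Z : PreGalois Γ} (s : Y ⟶ Z) (T : PreGalois Γ) :
    wR (wL X s) T ≫ inc (α_ X.of Z.of T.of).hom =
      inc (α_ X.of Y.of T.of).hom ≫ wL X (wR s T) := by
  ext
  rw [comp_inc_hom, inc_comp_hom]
  simp only [wR, wL]
  monoidal

lemma nat3 (X Y : PreGalois Γ) {Z T : PreGalois Γ} (s : Z ⟶ T) :
    wL ⟨X.of ⊗ Y.of⟩ s ≫ inc (α_ X.of Y.of T.of).hom =
      inc (α_ X.of Y.of Z.of).hom ≫ wL X (wL Y s) := by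
  ext
  rw [comp_inc_hom, inc_comp_hom]
  simp only [wL, BraidedCategory.braiding_tensor_right_hom]
  monoidal

lemma natl {X Y : PreGalois Γ} (s : X ⟶ Y) :
    wL ⟨𝟙_ C⟩ s ≫ inc (λ_ Y.of).hom = inc (λ_ X.of).hom ≫ s := by
  ext
  rw [comp_inc_hom, inc_comp_hom]
  simp only [wL, braiding_tensorUnit_right]
  monoidal

lemma natr {X Y : PreGalois Γ} (s : X ⟶ Y) :
    wR s ⟨𝟙_ C⟩ ≫ inc (ρ_ Y.of).hom = inc (ρ_ X.of).hom ≫ s := by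
  ext
  rw [comp_inc_hom, inc_comp_hom]
  simp only [wR]
  monoidal


instance [IsCommComonObj Γ] : MonoidalCategory (PreGalois Γ) where
  tensorObj X Y := ⟨X.of ⊗ Y.of⟩
  tensorUnit := ⟨𝟙_ C⟩
  tensorHom s t := tH s t
  whiskerLeft X _ _ t := wL X t
  whiskerRight s Z := wR s Z
  associator X Y Z := incIso (α_ X.of Y.of Z.of)
  leftUnitor X := incIso (λ_ X.of)
  rightUnitor X := incIso (ρ_ X.of)
  tensorHom_def s t := tH_def s t
  id_tensorHom_id X Y := by
    rw [tH_def, ← inc_id X.of, ← inc_id Y.of, wR_inc, wL_inc, ← inc_comp]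
    simp [inc_id]
  tensorHom_comp_tensorHom f₁ f₂ g₁ g₂ := by
    simp only [tH_def, wL_comp, wR_comp, Category.assoc]
    have h := exch_aux g₁ f₂
    rw [tH_def] at h
    rw [← reassoc_of% h]
  whiskerLeft_id X Y := by rw [← inc_id Y.of, wL_inc, whiskerLeft_id, inc_id]
  id_whiskerRight X Y := by rw [← inc_id X.of, wR_inc, id_whiskerRight, inc_id]
  associator_naturality {X₁ X₂ X₃ Y₁ Y₂ Y₃} f₁ f₂ f₃ := by
    simp only [tH_def, wL_comp, wR_comp, Category.assoc, incIso]
    erw [nat3, ← Category.assoc (wR (wL _ _) _), nat2, Category.assoc,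
      ← Category.assoc (wR (wR _ _) _), nat1, Category.assoc]
  leftUnitor_naturality s := natl s
  rightUnitor_naturality s := natr s
  pentagon W X Y Z := by
    simp only [incIso, wL_inc, wR_inc, ← inc_comp, pentagon]
  triangle X Y := by
    simp only [incIso, wL_inc, wR_inc, ← inc_comp, triangle]

end monoidal
end PreGalois

end PreGaloisSection

section KaroubiTensor

variable {D : Type u} [Category.{v} D] [MonoidalCategory D]

/-- The tensor product of the completion with respect to splitting idempotents:
`(X, p) ⊗ (Y, q) = (X ⊗ Y, p ⊗ q)`. -/
instance karoubiMonoidal : MonoidalCategory (Karoubi D) where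
  tensorObj P Q := ⟨P.X ⊗ Q.X, P.p ⊗ₘ Q.p, by simp⟩
  tensorUnit := ⟨𝟙_ D, 𝟙 _, by simp⟩
  tensorHom s t := ⟨s.f ⊗ₘ t.f, by simp⟩
  whiskerLeft P _ _ t := ⟨P.p ⊗ₘ t.f, by simp⟩
  whiskerRight s Q := ⟨s.f ⊗ₘ Q.p, by simp⟩
  associator P Q R :=
    { hom := ⟨((P.p ⊗ₘ Q.p) ⊗ₘ R.p) ≫ (α_ P.X Q.X R.X).hom, by simp⟩
      inv := ⟨(P.p ⊗ₘ (Q.p ⊗ₘ R.p)) ≫ (α_ P.X Q.X R.X).inv, by simp⟩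
      hom_inv_id := by ext; simp
      inv_hom_id := by ext; simp }
  leftUnitor P :=
    { hom := ⟨(𝟙 _ ⊗ₘ P.p) ≫ (λ_ P.X).hom, by simp⟩
      inv := ⟨P.p ≫ (λ_ P.X).inv, by simp⟩
      hom_inv_id := by ext; simp
      inv_hom_id := by ext; simp }
  rightUnitor P :=
    { hom := ⟨(P.p ⊗ₘ 𝟙 _) ≫ (ρ_ P.X).hom, by simp⟩
      inv := ⟨P.p ≫ (ρ_ P.X).inv, by simp⟩
      hom_inv_id := by ext; simp
      inv_hom_id := by ext; simp }
  tensorHom_def s t := by ext; simp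
  id_tensorHom_id P Q := by ext; simp
  tensorHom_comp_tensorHom f₁ f₂ g₁ g₂ := by ext; simp
  whiskerLeft_id P Q := by ext; simp
  id_whiskerRight P Q := by ext; simp
  associator_naturality f₁ f₂ f₃ := by ext; simp
  leftUnitor_naturality f := by ext; simp
  rightUnitor_naturality f := by ext; simp
  pentagon P Q R S := by
    have e1 : ((P.p ⊗ₘ Q.p) ⊗ₘ R.p) ≫ (α_ P.X Q.X R.X).hom ⊗ₘ S.p =
        (((P.p ⊗ₘ Q.p) ⊗ₘ R.p) ⊗ₘ S.p) ≫ (α_ P.X Q.X R.X).hom ▷ S.X := by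
      rw [← tensorHom_id, tensorHom_comp_tensorHom, Category.comp_id]
    have e2 : P.p ⊗ₘ ((Q.p ⊗ₘ R.p) ⊗ₘ S.p) ≫ (α_ Q.X R.X S.X).hom =
        (P.p ⊗ₘ ((Q.p ⊗ₘ R.p) ⊗ₘ S.p)) ≫ P.X ◁ (α_ Q.X R.X S.X).hom := by
      rw [← id_tensorHom, tensorHom_comp_tensorHom, Category.comp_id]
    have e3 : (((P.p ⊗ₘ Q.p) ⊗ₘ R.p) ⊗ₘ S.p) ≫ (α_ P.X Q.X R.X).hom ▷ S.X =
        (α_ P.X Q.X R.X).hom ▷ S.X ≫ ((P.p ⊗ₘ (Q.p ⊗ₘ R.p)) ⊗ₘ S.p) := by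
      rw [← tensorHom_id, tensorHom_comp_tensorHom, tensorHom_comp_tensorHom,
        Category.comp_id, Category.id_comp, associator_naturality]
    ext
    change (((P.p ⊗ₘ Q.p) ⊗ₘ R.p) ≫ (α_ P.X Q.X R.X).hom ⊗ₘ S.p) ≫
      (((P.p ⊗ₘ (Q.p ⊗ₘ R.p)) ⊗ₘ S.p) ≫ (α_ P.X (Q.X ⊗ R.X) S.X).hom) ≫
      (P.p ⊗ₘ ((Q.p ⊗ₘ R.p) ⊗ₘ S.p) ≫ (α_ Q.X R.X S.X).hom) =
      ((((P.p ⊗ₘ Q.p) ⊗ₘ R.p) ⊗ₘ S.p) ≫ (α_ (P.X ⊗ Q.X) R.X S.X).hom) ≫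
      (((P.p ⊗ₘ Q.p) ⊗ₘ (R.p ⊗ₘ S.p)) ≫ (α_ P.X Q.X (R.X ⊗ S.X)).hom)
    rw [e1, e2, e3]
    simp only [Category.assoc, tensorHom_comp_tensorHom_assoc, tensorHom_comp_tensorHom,
      associator_naturality_assoc, Karoubi.idem]
    rw [← associator_naturality_assoc, associator_naturality, ← pentagon_assoc]
    rw [associator_naturality_assoc, ← id_tensorHom, tensorHom_comp_tensorHom,
      tensorHom_comp_tensorHom, Category.id_comp, Category.comp_id, associator_naturality]
  triangle P Q := by
    have e1 : (P.p ⊗ₘ 𝟙 (𝟙_ D)) ≫ (ρ_ P.X).hom ⊗ₘ Q.p =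
        ((P.p ⊗ₘ 𝟙 (𝟙_ D)) ⊗ₘ Q.p) ≫ (ρ_ P.X).hom ▷ Q.X := by
      rw [← tensorHom_id, tensorHom_comp_tensorHom, Category.comp_id]
    have e2 : P.p ⊗ₘ (𝟙 (𝟙_ D) ⊗ₘ Q.p) ≫ (λ_ Q.X).hom =
        (P.p ⊗ₘ (𝟙 (𝟙_ D) ⊗ₘ Q.p)) ≫ P.X ◁ (λ_ Q.X).hom := by
      rw [← id_tensorHom, tensorHom_comp_tensorHom, Category.comp_id]
    ext
    change (((P.p ⊗ₘ 𝟙 (𝟙_ D)) ⊗ₘ Q.p) ≫ (α_ P.X (𝟙_ D) Q.X).hom) ≫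
      (P.p ⊗ₘ (𝟙 (𝟙_ D) ⊗ₘ Q.p) ≫ (λ_ Q.X).hom) = (P.p ⊗ₘ 𝟙 (𝟙_ D)) ≫ (ρ_ P.X).hom ⊗ₘ Q.p
    rw [e1, e2, associator_naturality, Category.assoc, tensorHom_comp_tensorHom_assoc,
      tensorHom_comp_tensorHom]
    simp only [Karoubi.idem, Category.comp_id]
    rw [← associator_naturality_assoc, triangle]

end KaroubiTensor

namespace RegularAlgebra

variable (F G : Type w) [Field F] [Group G]

/-- The left regular representation on functions, `(g f)(h) = f(g⁻¹ h)`. -/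
def rho : Representation F G (G → F) where
  toFun g := LinearMap.funLeft F F (fun h => g⁻¹ * h)
  map_one' := by ext; simp [LinearMap.funLeft]
  map_mul' g h := by ext; simp [LinearMap.funLeft, mul_assoc]

lemma rho_apply (g : G) (f : G → F) (h : G) : rho F G g f h = f (g⁻¹ * h) := rfl

lemma rho_single [DecidableEq G] (g h : G) :
    rho F G g (Pi.single h 1) = Pi.single (g * h) 1 := by
  ext k
  simp only [rho_apply, Pi.single_apply, inv_mul_eq_iff_eq_mul]

variable [Fintype G] [DecidableEq G]

/-- Comultiplication `δ_g ↦ |G| δ_g ⊗ δ_g`. -/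
def comulLin : (G → F) →ₗ[F] (G → F) ⊗[F] (G → F) :=
  ∑ g : G, (Fintype.card G : F) • (LinearMap.proj g).smulRight
    ((Pi.single g (1 : F) : G → F) ⊗ₜ[F] (Pi.single g (1 : F) : G → F))

/-- Counit `δ_g ↦ |G|⁻¹`. -/
def counitLin : (G → F) →ₗ[F] F :=
  ∑ g : G, (Fintype.card G : F)⁻¹ • LinearMap.proj g

lemma comulLin_apply (f : G → F) : comulLin F G f = ∑ g : G, (Fintype.card G : F) • f g •
    ((Pi.single g (1 : F) : G → F) ⊗ₜ[F] (Pi.single g (1 : F) : G → F)) := by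
  simp [comulLin]

lemma counitLin_apply (f : G → F) : counitLin F G f = (Fintype.card G : F)⁻¹ * ∑ g : G, f g := by
  simp [counitLin, Finset.mul_sum]

lemma comulLin_single (g : G) : comulLin F G (Pi.single g 1) = (Fintype.card G : F) •
    ((Pi.single g (1 : F) : G → F) ⊗ₜ[F] (Pi.single g (1 : F) : G → F)) := by
  rw [comulLin_apply, Finset.sum_eq_single g]
  · simp
  · intro b _ hb
    simp [hb]
  · simp

lemma counitLin_single (g : G) : counitLin F G (Pi.single g 1) = (Fintype.card G : F)⁻¹ := by
  simp [counitLin_apply]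

lemma counit_comul_lin [CharZero F] : (counitLin F G).rTensor (G → F) ∘ₗ comulLin F G =
    TensorProduct.mk F F (G → F) 1 := by
  refine LinearMap.pi_ext' fun g => LinearMap.ext_ring ?_
  have : (Fintype.card G : F) ≠ 0 := by simp
  simp only [LinearMap.comp_apply, LinearMap.single_apply, comulLin_single, map_smul,
    LinearMap.rTensor_tmul, counitLin_single, TensorProduct.mk_apply]
  rw [TensorProduct.smul_tmul', smul_eq_mul, mul_inv_cancel₀ this]

lemma comul_counit_lin [CharZero F] : (counitLin F G).lTensor (G → F) ∘ₗ comulLin F G =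
    (TensorProduct.mk F (G → F) F).flip 1 := by
  refine LinearMap.pi_ext' fun g => LinearMap.ext_ring ?_
  have : (Fintype.card G : F) ≠ 0 := by simp
  simp only [LinearMap.comp_apply, LinearMap.single_apply, comulLin_single, map_smul,
    LinearMap.lTensor_tmul, counitLin_single, TensorProduct.mk_apply, LinearMap.flip_apply]
  rw [← TensorProduct.tmul_smul, smul_eq_mul, mul_inv_cancel₀ this]

lemma comul_assoc_lin : (comulLin F G).lTensor (G → F) ∘ₗ comulLin F G =
    (TensorProduct.assoc F (G → F) (G → F) (G → F)).toLinearMap ∘ₗ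
      (comulLin F G).rTensor (G → F) ∘ₗ comulLin F G := by
  refine LinearMap.pi_ext' fun g => LinearMap.ext_ring ?_
  simp only [LinearMap.comp_apply, LinearMap.single_apply, comulLin_single, map_smul,
    LinearMap.lTensor_tmul, LinearMap.rTensor_tmul, TensorProduct.tmul_smul,
    ← TensorProduct.smul_tmul', LinearEquiv.coe_coe, TensorProduct.assoc_tmul]

/-- The regular representation as an object of `Rep G`. -/
def reg : FDRep F G := FDRep.of (rho F G)

/-- An intertwiner from an equivariant linear map. -/
def mkHom {V W : FDRep F G} (l : V →ₗ[F] W) (h : ∀ g, l ∘ₗ V.ρ g = W.ρ g ∘ₗ l) : V ⟶ W where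
  hom := ObjectProperty.homMk (ModuleCat.ofHom l)
  comm g := FGModuleCat.hom_ext (h g)

theorem hom_ext' {V W : FDRep F G} {f g : V ⟶ W} (h : f.hom.hom.hom = g.hom.hom.hom) : f = g :=
  Action.Hom.ext (FGModuleCat.hom_ext h)

/-- Multiplication `δ_g ⊗ δ_h ↦ δ_{g,h} δ_g`. -/
def mul : reg F G ⊗ reg F G ⟶ reg F G :=
  mkHom F G (V := reg F G ⊗ reg F G) (W := reg F G) (LinearMap.mul' F (G → F)) fun g => by
    apply TensorProduct.ext'
    intro x y
    rfl

/-- Unit `1 ↦ ∑_g δ_g`. -/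
def one : 𝟙_ (FDRep F G) ⟶ reg F G :=
  mkHom F G (V := 𝟙_ (FDRep F G)) (W := reg F G) (Algebra.linearMap F (G → F)) fun g => by
    apply LinearMap.ext
    intro x
    rfl

/-- Comultiplication as an intertwiner. -/
def comul : reg F G ⟶ reg F G ⊗ reg F G :=
  mkHom F G (V := reg F G) (W := reg F G ⊗ reg F G) (comulLin F G) fun g => by
    refine LinearMap.pi_ext' fun h => LinearMap.ext_ring ?_
    have : comulLin F G (rho F G g (Pi.single h 1)) =
        TensorProduct.map (rho F G g) (rho F G g) (comulLin F G (Pi.single h 1)) := by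
      rw [rho_single, comulLin_single, comulLin_single, map_smul, TensorProduct.map_tmul,
        rho_single]
    exact this

/-- Counit as an intertwiner. -/
def counit : reg F G ⟶ 𝟙_ (FDRep F G) :=
  mkHom F G (V := reg F G) (W := 𝟙_ (FDRep F G)) (counitLin F G) fun g => by
    refine LinearMap.pi_ext' fun h => LinearMap.ext_ring ?_
    have : counitLin F G (rho F G g (Pi.single h 1)) = counitLin F G (Pi.single h 1) := by
      rw [rho_single, counitLin_single, counitLin_single]
    exact this

/-- The monoid part: pointwise multiplication of functions. -/
instance : MonObj (reg F G) where
  one := one F G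
  mul := mul F G
  one_mul := by
    apply hom_ext'
    apply TensorProduct.ext'
    intro x y
    exact (Algebra.smul_def (A := G → F) x y).symm
  mul_one := by
    apply hom_ext'
    apply TensorProduct.ext'
    intro x y
    exact (Algebra.commutes (A := G → F) y x).symm.trans (Algebra.smul_def (A := G → F) y x).symm
  mul_assoc := by
    apply hom_ext'
    apply TensorProduct.ext_threefold
    intro x y z
    exact _root_.mul_assoc (G := G → F) x y z

/-- The comonoid part, with `Δ(δ_g) = |G| δ_g ⊗ δ_g`, `ε(δ_g) = 1/|G|`. -/
instance [CharZero F] : ComonObj (reg F G) where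
  counit := counit F G
  comul := comul F G
  counit_comul := by
    apply hom_ext'
    exact counit_comul_lin F G
  comul_counit := by
    apply hom_ext'
    exact comul_counit_lin F G
  comul_assoc := by
    apply hom_ext'
    refine LinearMap.pi_ext' fun h => LinearMap.ext_ring ?_
    have h1 := LinearMap.congr_fun (comul_assoc_lin F G) (Pi.single h 1)
    refine Eq.trans (b := ((comulLin F G).lTensor (G → F) ∘ₗ comulLin F G) (Pi.single h 1)) ?_ (h1.trans ?_)
    · rfl
    · have h2 : ∀ t : ((G → F) ⊗[F] (G → F)) ⊗[F] (G → F), TensorProduct.assoc F (G → F) (G → F) (G → F) t = ((α_ (reg F G) (reg F G) (reg F G)).hom.hom.hom.hom) t := by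
        intro t
        rw [Action.associator_hom_hom]
        rfl
      exact h2 _

instance [CharZero F] : IsCommComonObj (reg F G) where
  comul_comm := by
    apply hom_ext'
    refine LinearMap.pi_ext' fun h => LinearMap.ext_ring ?_
    have : TensorProduct.comm F (G → F) (G → F) (comulLin F G (Pi.single h 1)) =
        comulLin F G (Pi.single h 1) := by
      rw [comulLin_single, map_smul, TensorProduct.comm_tmul]
    exact this

end RegularAlgebra

section CrossedCategories

/-- `X` is the (finite) direct sum of the family `Y`. -/
def IsDirectSum {D : Type u} [Category.{v} D] [Preadditive D] {n : ℕ} (Y : Fin n → D) (X : D) :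
    Prop :=
  ∃ b : Bicone Y, Nonempty b.IsBilimit ∧ Nonempty (X ≅ b.pt)

/-- Every object is a finite direct sum of simple objects. -/
def IsSemisimpleCat (D : Type u) [Category.{v} D] [Preadditive D] : Prop :=
  ∀ X : D, ∃ (n : ℕ) (Y : Fin n → D), (∀ i, Simple (Y i)) ∧ IsDirectSum Y X

/-- A strict tensor category: tensor products are strictly associative and unital, and the
constraint isomorphisms are identities. -/
structure IsStrictTensorCat (D : Type u) [Category.{v} D] [MonoidalCategory D] : Prop where
  assoc : ∀ X Y Z : D, ∃ h : (X ⊗ Y) ⊗ Z = X ⊗ (Y ⊗ Z), (α_ X Y Z).hom = eqToHom h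
  unit_left : ∀ X : D, ∃ h : 𝟙_ D ⊗ X = X, (λ_ X).hom = eqToHom h
  unit_right : ∀ X : D, ∃ h : X ⊗ 𝟙_ D = X, (ρ_ X).hom = eqToHom h

/-- A strict tensor functor: it preserves tensor products and the unit on the nose, i.e. it is
monoidal with identities as structure morphisms. -/
def IsStrictTensorFunctor {D : Type u} [Category.{v} D] [MonoidalCategory D] (T : D ⥤ D) : Prop :=
  ∃ _ : T.Monoidal,
    (∀ X Y : D, ∃ h : T.obj X ⊗ T.obj Y = T.obj (X ⊗ Y),
      Functor.LaxMonoidal.μ T X Y = eqToHom h) ∧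
    ∃ h : 𝟙_ D = T.obj (𝟙_ D), Functor.LaxMonoidal.ε T = eqToHom h

/-- The structure of a crossed `G`-category on an additive tensor category `D`: a full tensor
subcategory of homogeneous objects graded by `G`, and a strict action of `G` by strict tensor
automorphisms (invertible since `action` is multiplicative and unital).  Strictness of the tensor
category `D` itself is the separate property `IsStrictTensorCat D`. -/
structure CrossedCategory (G : Type w) [Group G] (D : Type u) [Category.{v} D] [Preadditive D]
    [MonoidalCategory D] where
  /-- the homogeneous objects -/
  homogeneous : ObjectProperty D
  isMonoidal : homogeneous.IsMonoidal
  /-- the grade `∂` -/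
  grade : ∀ X : D, homogeneous X → G
  grade_iso : ∀ (X Y : D) (hX : homogeneous X) (hY : homogeneous Y), Nonempty (X ≅ Y) →
    grade X hX = grade Y hY
  /-- the action `γ` -/
  action : G → D ⥤ D
  action_one : action 1 = 𝟭 D
  action_mul : ∀ g h : G, action (g * h) = action h ⋙ action g
  action_strict : ∀ g : G, IsStrictTensorFunctor (action g)
  grade_tensor : ∀ (X Y : D) (hX : homogeneous X) (hY : homogeneous Y)
    (hXY : homogeneous (X ⊗ Y)), grade (X ⊗ Y) hXY = grade X hX * grade Y hY
  grade_action : ∀ (g : G) (X : D) (hX : homogeneous X),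
    ∃ h : homogeneous ((action g).obj X), grade ((action g).obj X) h = g * grade X hX * g⁻¹
  exists_directSum : ∀ X : D, ∃ (n : ℕ) (Y : Fin n → D),
    (∀ i, homogeneous (Y i)) ∧ IsDirectSum Y X

end CrossedCategories

section GaloisExtension

variable {C : Type u} [Category.{v} C] [MonoidalCategory C]

/-- The category `C ⋊ S` belonging to the comonoid `Γ`: objects are the pairs `(X, p)` with `p` an
idempotent endomorphism of `X` in `C ⋊₀ S`. -/
abbrev GaloisCat (Γ : C) [ComonObj Γ] := Karoubi (PreGalois Γ)

/-- The group `Aut(Γ, m, η)` of automorphisms of the monoid `Γ`; the product is composition,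
`g * h = g ∘ h`. -/
abbrev GaloisGroup (Γ : C) [MonObj Γ] := Aut (Mon.mk Γ)

/-- The automorphism of the object `Γ` underlying an element of `Aut(Γ, m, η)`. -/
def GaloisGroup.toHom {Γ : C} [MonObj Γ] (g : GaloisGroup Γ) : Γ ⟶ Γ := g.hom.hom

variable (Γ : C) [MonObj Γ] [ComonObj Γ]

/-- `γ_g(s) = s ∘ (g⁻¹ ⊗ id_X)` for `s ∈ Hom_C(Γ ⊗ X, Y)`. -/
def galoisMap (g : GaloisGroup Γ) {X Y : PreGalois Γ} (s : X ⟶ Y) : X ⟶ Y :=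
  ⟨(g⁻¹).toHom ▷ X.of ≫ s.hom⟩

/-- `act` is the action of `Aut(Γ, m, η)` given by `γ_g((X, p)) = (X, γ_g(p))` on objects and by
`γ_g(s) = s ∘ (g⁻¹ ⊗ id)` on morphisms. -/
def IsGaloisAction (act : GaloisGroup Γ → GaloisCat Γ ⥤ GaloisCat Γ) : Prop :=
  ∀ g : GaloisGroup Γ,
    (∀ P : GaloisCat Γ, ∃ h, (act g).obj P = ⟨P.X, galoisMap Γ g P.p, h⟩) ∧
    ∀ (P Q : GaloisCat Γ) (s : P ⟶ Q), HEq ((act g).map s).f (galoisMap Γ g s.f)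

variable [BraidedCategory C] [IsCommComonObj Γ]

/-- `∂(X, p) = f`: there is `∂' : Γ ⟶ Γ` in `C ⋊₀ S` with
`ι(c_{Γ,X}⁻¹ ∘ c_{X,Γ}⁻¹) ∘ (id_Γ ⊗ p) = ∂' ⊗ p` and `f = ∂' ∘ Δ` in `C`. -/
def IsDegree (P : GaloisCat Γ) (f : Γ ⟶ Γ) : Prop :=
  ∃ d : (⟨Γ⟩ : PreGalois Γ) ⟶ ⟨Γ⟩,
    ((⟨Γ⟩ : PreGalois Γ) ◁ P.p) ≫ PreGalois.inc ((β_ P.X.of Γ).inv ≫ (β_ Γ P.X.of).inv) =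
      d ⊗ₘ P.p ∧
    Δ[Γ] ≫ d.hom = f

/-- `P` is homogeneous of grade `g`: it is a non-empty finite direct sum of simple objects
`Y i` with `∂ (Y i) = g`. -/
def IsHomogeneousOfGrade [Preadditive C] [MonoidalPreadditive C] (P : GaloisCat Γ)
    (g : GaloisGroup Γ) : Prop :=
  ∃ (n : ℕ) (Y : Fin n → GaloisCat Γ), 0 < n ∧
    (∀ i, Simple (Y i) ∧ IsDegree Γ (Y i) g.toHom) ∧ IsDirectSum Y P

end GaloisExtension

section RegularObject

lemma comul_comm_obj {A : Type*} [Category* A] [MonoidalCategory A] [BraidedCategory A]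
    {B : Type*} [Category* B] [MonoidalCategory B] [BraidedCategory B] (P : A ⥤ B) [P.Braided]
    (X : A) [ComonObj X] [IsCommComonObj X] :
    (P.map Δ[X] ≫ Functor.OplaxMonoidal.δ P X X) ≫ (β_ (P.obj X) (P.obj X)).hom =
      P.map Δ[X] ≫ Functor.OplaxMonoidal.δ P X X := by
  have h2 : Functor.OplaxMonoidal.δ P X X ≫ (β_ (P.obj X) (P.obj X)).hom =
      P.map (β_ X X).hom ≫ Functor.OplaxMonoidal.δ P X X := by
    rw [Functor.map_braiding P X X]
    simp
  rw [Category.assoc, h2, ← P.map_comp_assoc, IsCommComonObj.comul_comm]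

variable {F G : Type w} [Field F] [Group G] [Fintype G] [DecidableEq G]
  {C : Type u} [Category.{v} C] [MonoidalCategory C] [BraidedCategory C]
  (S : ObjectProperty C) [S.IsMonoidal]
  (Φ : FDRep F G ≌ S.FullSubcategory) [Φ.functor.Braided]

/-- The object `Γ` of `S ⊆ C` which corresponds to the regular representation under the
equivalence `Rep G ≃ S`. -/
def regularObj : C := (Φ.functor ⋙ S.ι).obj (RegularAlgebra.reg F G)

/-- The monoid structure of `Γ`. -/
instance : MonObj (regularObj S Φ) :=
  Functor.monObjObj (F := Φ.functor ⋙ S.ι) (RegularAlgebra.reg F G)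

/-- The comonoid structure of `Γ`. -/
instance [CharZero F] : ComonObj (regularObj S Φ) :=
  Functor.obj.instComonObj (RegularAlgebra.reg F G) (Φ.functor ⋙ S.ι)

instance [CharZero F] : IsCommComonObj (regularObj S Φ) where
  comul_comm := comul_comm_obj (Φ.functor ⋙ S.ι) (RegularAlgebra.reg F G)

end RegularObject

end

/-! The proof rests on two facts. In `C ⋊₀ S` the object `Γ` splits into copies of the unit indexed
by `Aut(Γ)`, and the inverse monodromy of `Γ` with `X` is natural in `X` for all morphisms of `C ⋊₀
S`, because `Γ` has trivial monodromy with itself.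

The splitting is given by points `1 ⟶ Γ`, one for each automorphism, and dual copoints `Γ ⟶ 1`
(`point_comp_copoint`, `sum_copoint_comp_point`). Placing the monodromy between the point of the
identity and the copoint of `g` gives an endomorphism `component g X`. These are natural in `X`,
orthogonal idempotents, and sum to the identity, so a simple object lives in exactly one of them,
and this is its grade.

Grades are handled through morphisms: `IsGraded f p` says that the monodromy turns the identity
point next to `p` into the point `f`. The condition passes to composites, sums and tensor products,
and a non-zero `p` has at most one grade in `Aut(Γ)`. By `isHomogeneousOfGrade_iff`, homogeneity of
`(X, p)` becomes "`p` is graded and non-zero". Multiplicativity of the grade is then the hexagon.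
The conjugation rule holds because `γ_g` fixes the monodromy and moves the points.

Semisimplicity is obtained from generalized inverses: every morphism `f` of `C` has an `r` with `f r
f = f`; a Maschke average over the Frobenius algebra `Γ` carries this to `C ⋊₀ S`;
finite-dimensionality then makes the idempotent completion semisimple. Generalized inverses,
rigidity and a unit with only trivial idempotents also show that tensor products of non-zero
idempotents are non-zero.

The properties of `Γ` that are used are collected in `IsGaloisObject`. They are checked on the basis
`δ_g` of the regular representation, whose algebra automorphisms are the right translations, and
transported along the monoidal functor `Rep G ⟶ S ⟶ C`. -/

set_option linter.unusedSectionVars false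

noncomputable section

/-! ### Generalized inverses and semisimplicity of the idempotent completion -/

section Semisimple

/-- Every morphism has a generalized inverse. -/
def IsRegularCat (D : Type u) [Category.{v} D] : Prop :=
  ∀ ⦃X Y : D⦄ (f : X ⟶ Y), ∃ r : Y ⟶ X, f ≫ r ≫ f = f

lemma IsDirectSum.exists_maps {D : Type u} [Category.{v} D] [Preadditive D] {n : ℕ}
    {Y : Fin n → D} {X : D} (h : IsDirectSum Y X) :
    ∃ (i : ∀ j, Y j ⟶ X) (p : ∀ j, X ⟶ Y j), (∀ j, i j ≫ p j = 𝟙 _) ∧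
      (∀ j k, j ≠ k → i j ≫ p k = 0) ∧ ∑ j, p j ≫ i j = 𝟙 X := by
  obtain ⟨b, ⟨hb⟩, ⟨e⟩⟩ := h
  refine ⟨fun j => b.ι j ≫ e.inv, fun j => e.hom ≫ b.π j, fun j => by simp,
    fun j k hjk => by simp [bicone_ι_π_ne b hjk], ?_⟩
  have h1 := congrArg (fun t => e.hom ≫ t ≫ e.inv) (IsBilimit.total hb)
  simp only [Preadditive.sum_comp, Preadditive.comp_sum, Category.assoc, Category.id_comp,
    Iso.hom_inv_id] at h1
  simpa using h1

lemma isDirectSum_of_maps {D : Type u} [Category.{v} D] [Preadditive D] {n : ℕ}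
    {Y : Fin n → D} {X : D} (i : ∀ j, Y j ⟶ X) (p : ∀ j, X ⟶ Y j) (h1 : ∀ j, i j ≫ p j = 𝟙 _)
    (h2 : ∀ j k, j ≠ k → i j ≫ p k = 0) (h3 : ∑ j, p j ≫ i j = 𝟙 X) : IsDirectSum Y X := by
  classical
  let b : Bicone Y :=
    { pt := X
      π := p
      ι := i
      ι_π := fun j k => by
        split_ifs with e
        · subst e
          simpa using h1 j
        · exact h2 j k e }
  exact ⟨b, ⟨isBilimitOfTotal b h3⟩, ⟨Iso.refl _⟩⟩

/-- In a semisimple abelian category every morphism has a generalized inverse. -/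
lemma IsSemisimpleCat.isRegularCat {C : Type u} [Category.{v} C] [Abelian C]
    (h : IsSemisimpleCat C) : IsRegularCat C := by
  intro X Y f
  -- Some coordinate of `g` in a decomposition of `Y` is a non-zero map of simple objects, hence
  -- invertible.
  have retr : ∀ (S : C) [Simple S] (g : S ⟶ Y), g ≠ 0 → ∃ t : Y ⟶ S, g ≫ t = 𝟙 S := by
    intro S _ g hg
    obtain ⟨n, Z, hZ, hY⟩ := h Y
    obtain ⟨i, p, h1, h2, h3⟩ := hY.exists_maps
    have : ∃ j, g ≫ p j ≠ 0 := by
      by_contra! hc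
      apply hg
      rw [← Category.comp_id g, ← h3, Preadditive.comp_sum]
      exact Finset.sum_eq_zero fun j _ => by rw [← Category.assoc, hc, zero_comp]
    obtain ⟨j, hj⟩ := this
    have := hZ j
    have := isIso_of_hom_simple hj
    exact ⟨p j ≫ inv (g ≫ p j), by rw [← Category.assoc, IsIso.hom_inv_id]⟩
  obtain ⟨n, Z, hZ, hX⟩ := h X
  obtain ⟨i, p, h1, h2, h3⟩ := hX.exists_maps
  classical
  -- The generalized inverse is built up one simple summand of `X` at a time.
  have key : ∀ s : Finset (Fin n), ∃ r : Y ⟶ X,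
      ((∑ j ∈ s, p j ≫ i j) ≫ f) ≫ r ≫ f = (∑ j ∈ s, p j ≫ i j) ≫ f := by
    intro s
    induction s using Finset.induction_on with
    | empty => exact ⟨0, by simp⟩
    | insert k s hk ih =>
      obtain ⟨r, hf⟩ := ih
      rw [Finset.sum_insert hk]
      set h' := (∑ j ∈ s, p j ≫ i j) ≫ f with hh'
      -- If the new summand is already reproduced by `r`, nothing changes. Otherwise its residual
      -- part is a non-zero map out of a simple object and has a retraction.
      by_cases hg : i k ≫ f ≫ (𝟙 Y - r ≫ f) = 0
      · refine ⟨r, ?_⟩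
        have e1 : i k ≫ f ≫ r ≫ f = i k ≫ f := by
          rw [Preadditive.comp_sub, Preadditive.comp_sub, sub_eq_zero, Category.comp_id] at hg
          exact hg.symm
        simp only [Preadditive.add_comp, Category.assoc, e1, ← hh']
        simp only [hh', Category.assoc] at hf ⊢
        rw [hf]
      · have := hZ k
        obtain ⟨t, ht⟩ := retr (Z k) _ hg
        have e0 : h' ≫ (𝟙 Y - r ≫ f) = 0 := by
          rw [Preadditive.comp_sub, Category.comp_id, hf, sub_self]
        set t' := (𝟙 Y - r ≫ f) ≫ t with ht'
        have e1 : h' ≫ t' = 0 := by rw [ht', reassoc_of% e0, zero_comp]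
        have e2 : i k ≫ f ≫ t' = 𝟙 _ := by simpa only [ht', Category.assoc] using ht
        -- Since `t'` kills the image of the earlier summands and retracts the image of the new one,
        -- `r` is first corrected to vanish on the new image, and then the new inverse is added.
        refine ⟨(𝟙 Y - t' ≫ i k ≫ f) ≫ r + t' ≫ i k, ?_⟩
        · have e3 : h' ≫ ((𝟙 Y - t' ≫ i k ≫ f) ≫ r + t' ≫ i k) ≫ f = h' := by
            simp only [Preadditive.comp_add, Preadditive.add_comp, Preadditive.sub_comp,
              Preadditive.comp_sub, Category.assoc, Category.id_comp]
            rw [reassoc_of% e1, reassoc_of% e1, hf]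
            simp
          have e4 : i k ≫ f ≫ ((𝟙 Y - t' ≫ i k ≫ f) ≫ r + t' ≫ i k) ≫ f = i k ≫ f := by
            simp only [Preadditive.comp_add, Preadditive.add_comp, Preadditive.sub_comp,
              Preadditive.comp_sub, Category.assoc, Category.id_comp]
            rw [reassoc_of% e2, reassoc_of% e2]
            simp
          rw [Preadditive.add_comp (f := p k ≫ i k), ← hh', Preadditive.add_comp, e3,
            Category.assoc, Category.assoc, e4, Category.assoc]
  obtain ⟨r, hr⟩ := key Finset.univ
  rw [h3, Category.id_comp] at hr
  exact ⟨r, hr⟩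

/-- In the completion `e` splits through the object `(P.X, e.f)`, whose inclusion into `P` is a
non-zero monomorphism and therefore invertible. -/
lemma Simple.eq_id_of_idem {D : Type u} [Category.{v} D] [Preadditive D] {P : Karoubi D} [Simple P]
    {e : P ⟶ P} (he : e ≫ e = e) (h0 : e ≠ 0) : e = 𝟙 P := by
  have hf : e.f ≫ e.f = e.f := congrArg Karoubi.Hom.f he
  let Q : Karoubi D := ⟨P.X, e.f, hf⟩
  let i : Q ⟶ P := ⟨e.f, by simp [Q, hf]⟩
  let r : P ⟶ Q := ⟨e.f, by simp [Q, hf]⟩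
  have h1 : i ≫ r = 𝟙 Q := Karoubi.hom_ext _ _ hf
  have h2 : r ≫ i = e := Karoubi.hom_ext _ _ hf
  have : Mono i := mono_of_mono_fac h1
  have : IsIso i := isIso_of_mono_of_nonzero fun h => h0 (by rw [← h2, h, comp_zero])
  rw [← h2, ← cancel_epi i, reassoc_of% h1, Category.comp_id]

/-- Over a regular category, an object of the completion without non-trivial idempotents is
simple. -/
lemma simple_of_forall_idem {D : Type u} [Category.{v} D] [Preadditive D] (h : IsRegularCat D)
    {P : Karoubi D} (h0 : P.p ≠ 0) (h1 : ∀ e : P ⟶ P, e ≫ e = e → e = 0 ∨ e = 𝟙 P) :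
    Simple P where
  mono_isIso_iff_nonzero {Q} f _ := by
    constructor
    · rintro hf rfl
      apply h0
      have : 𝟙 P = 0 := by rw [← IsIso.inv_hom_id (0 : Q ⟶ P), comp_zero]
      exact congrArg Karoubi.Hom.f this
    · intro hf
      obtain ⟨r, hr⟩ := h f.f
      let r' : P ⟶ Q := ⟨P.p ≫ r ≫ Q.p, by simp⟩
      have h2 : f ≫ r' ≫ f = f := by
        ext
        simp [r', hr]
      have h3 : r' ≫ f = 𝟙 P := by
        refine (h1 (r' ≫ f) (by rw [Category.assoc, h2])).resolve_left fun h3 => hf ?_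
        rw [← h2, h3, comp_zero]
      exact ⟨r', by rw [← cancel_mono f, Category.assoc, h2, Category.id_comp], h3⟩

/-- The completion of a regular category with finite-dimensional morphism spaces is semisimple. -/
lemma IsRegularCat.isSemisimpleCat_karoubi {F : Type w} [Field F] {D : Type u} [Category.{v} D]
    [Preadditive D] [Linear F D] (h : IsRegularCat D)
    (fd : ∀ X : D, FiniteDimensional F (X ⟶ X)) : IsSemisimpleCat (Karoubi D) := by
  -- The corner `p End(X) p` is the endomorphism space of `(X, p)`; its dimension is the induction
  -- measure.
  let W : ∀ P : Karoubi D, Submodule F (P.X ⟶ P.X) := fun P =>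
    { carrier := {s | P.p ≫ s ≫ P.p = s}
      add_mem' := fun {a b} ha hb => by
        simp only [Set.mem_ofPred_eq, Preadditive.add_comp, Preadditive.comp_add] at *
        rw [ha, hb]
      zero_mem' := by simp
      smul_mem' := fun c a ha => by
        simp only [Set.mem_ofPred_eq, Linear.smul_comp, Linear.comp_smul] at *
        rw [ha] }
  have main : ∀ (k : ℕ) (P : Karoubi D), Module.finrank F (W P) = k →
      ∃ (n : ℕ) (Y : Fin n → Karoubi D), (∀ i, Simple (Y i)) ∧ IsDirectSum Y P := by
    intro k
    induction k using Nat.strong_induction_on with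
    | _ k ih =>
    intro P hP
    by_cases h0 : P.p = 0
    · refine ⟨0, Fin.elim0, fun i => i.elim0, isDirectSum_of_maps (fun i => i.elim0)
        (fun i => i.elim0) (fun i => i.elim0) (fun i => i.elim0) ?_⟩
      ext
      simp [h0]
    by_cases h1 : ∀ e : P ⟶ P, e ≫ e = e → e = 0 ∨ e = 𝟙 P
    · have := simple_of_forall_idem h h0 h1
      refine ⟨1, fun _ => P, fun _ => this, isDirectSum_of_maps (fun _ => 𝟙 _)
        (fun _ => 𝟙 _) (fun _ => by simp) (fun i j hij => (hij (Subsingleton.elim _ _)).elim) ?_⟩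
      simp
    push Not at h1
    obtain ⟨e, he, he0, he1⟩ := h1
    -- The corner cut out by `e` is strictly smaller because it does not contain `P.p` unless `e` is
    -- the identity. This is applied to `e` and to `𝟙 P - e`.
    have split : ∀ e : P ⟶ P, e ≫ e = e → e ≠ 𝟙 P →
        ∃ (Q : Karoubi D) (i : Q ⟶ P) (r : P ⟶ Q), i ≫ r = 𝟙 Q ∧ r ≫ i = e ∧
        Module.finrank F (W Q) < k := by
      intro e he he1
      have hf : e.f ≫ e.f = e.f := congrArg Karoubi.Hom.f he
      refine ⟨⟨P.X, e.f, hf⟩, ⟨e.f, by simp [hf]⟩, ⟨e.f, by simp [hf]⟩,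
        Karoubi.hom_ext _ _ hf, Karoubi.hom_ext _ _ hf, ?_⟩
      rw [← hP]
      have := fd P.X
      refine Submodule.finrank_lt_finrank_of_lt (lt_of_le_of_ne ?_ ?_)
      · intro s (hs : e.f ≫ s ≫ e.f = s)
        change P.p ≫ s ≫ P.p = s
        rw [← hs]
        simp
      · intro hW
        have : P.p ∈ W P := by
          change P.p ≫ P.p ≫ P.p = P.p
          simp
        rw [← hW] at this
        have h2 : e.f ≫ P.p ≫ e.f = P.p := this
        apply he1
        ext
        simpa [hf] using h2
    obtain ⟨Q, i, r, hir, hri, hQ⟩ := split e he he1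
    obtain ⟨Q', i', r', hir', hri', hQ'⟩ := split (𝟙 P - e) (by simp [he]) (by simpa using he0)
    obtain ⟨n, Y, hY, hs⟩ := ih _ hQ Q rfl
    obtain ⟨n', Y', hY', hs'⟩ := ih _ hQ' Q' rfl
    obtain ⟨a, b, g1, g2, g3⟩ := hs.exists_maps
    obtain ⟨a', b', g1', g2', g3'⟩ := hs'.exists_maps
    have o1 : i ≫ r' = 0 := by
      have : i ≫ (𝟙 P - e) = 0 := by
        rw [← hri, Preadditive.comp_sub, reassoc_of% hir, Category.comp_id, sub_self]
      rw [← hri', ← Category.assoc] at this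
      simpa [hir'] using congrArg (· ≫ r') this
    have o2 : i' ≫ r = 0 := by
      have : i' ≫ e = 0 := by
        have e1 : e = 𝟙 P - r' ≫ i' := by rw [hri', sub_sub_cancel]
        rw [e1, Preadditive.comp_sub, reassoc_of% hir', Category.comp_id, sub_self]
      rw [← hri, ← Category.assoc] at this
      simpa [hir] using congrArg (· ≫ r) this
    refine ⟨n + n', Fin.append Y Y', ?_, isDirectSum_of_maps
      (Fin.addCases (fun j => eqToHom (Fin.append_left _ _ _) ≫ a j ≫ i)
        (fun j => eqToHom (Fin.append_right _ _ _) ≫ a' j ≫ i'))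
      (Fin.addCases (fun j => r ≫ b j ≫ eqToHom (Fin.append_left _ _ _).symm)
        (fun j => r' ≫ b' j ≫ eqToHom (Fin.append_right _ _ _).symm)) ?_ ?_ ?_⟩
    · intro j
      refine Fin.addCases (fun j => ?_) (fun j => ?_) j
      · rw [Fin.append_left]; exact hY j
      · rw [Fin.append_right]; exact hY' j
    · intro j
      refine Fin.addCases (fun j => ?_) (fun j => ?_) j
      · simp [reassoc_of% hir, reassoc_of% (g1 j)]
      · simp [reassoc_of% hir', reassoc_of% (g1' j)]
    · intro j l
      refine Fin.addCases (fun j => ?_) (fun j => ?_) j <;>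
      refine Fin.addCases (fun l => ?_) (fun l => ?_) l
      · intro hjl
        have : j ≠ l := fun h => hjl (by rw [h])
        simp [reassoc_of% hir, reassoc_of% (g2 j l this)]
      · intro _
        simp [reassoc_of% o1]
      · intro _
        simp [reassoc_of% o2]
      · intro hjl
        have : j ≠ l := fun h => hjl (by rw [h])
        simp [reassoc_of% hir', reassoc_of% (g2' j l this)]
    · rw [Fin.sum_univ_add]
      simp only [Fin.addCases_left, Fin.addCases_right, Category.assoc, eqToHom_trans_assoc,
        eqToHom_refl, Category.id_comp]
      have c1 : ∑ j, r ≫ b j ≫ a j ≫ i = e := by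
        have := congrArg (fun t => r ≫ t ≫ i) g3
        simpa [Preadditive.sum_comp, Preadditive.comp_sum, hri] using this
      have c2 : ∑ j, r' ≫ b' j ≫ a' j ≫ i' = 𝟙 P - e := by
        have := congrArg (fun t => r' ≫ t ≫ i') g3'
        simpa [Preadditive.sum_comp, Preadditive.comp_sum, hri'] using this
      rw [c1, c2]
      simp
  exact fun P => main _ P rfl

end Semisimple
end

noncomputable section

open scoped ComonObj MonObj TensorProduct

/-! ### Monoidal calculus for sliding points past objects -/

section Abstract

variable {D : Type u} [Category.{v} D] [MonoidalCategory D]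

/-- The point `v₀` becomes `v₁` at the first strand, slides past it through `b`, becomes `v₂` at the
second strand, and slides back. The long composite is the hexagon form of the monodromy with a
tensor product. -/
lemma tensor_point_comp_monodromy {A X X' Y Y' : D} {v₀ v₁ v₂ : 𝟙_ D ⟶ A} {p : X ⟶ X'}
    {q : Y ⟶ Y'} (b : A ⊗ X' ≅ X' ⊗ A) {mX : A ⊗ X' ⟶ A ⊗ X'} {mY : A ⊗ Y' ⟶ A ⊗ Y'}
    (hX : (v₀ ⊗ₘ p) ≫ mX = v₁ ⊗ₘ p) (hY : (v₁ ⊗ₘ q) ≫ mY = v₂ ⊗ₘ q)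
    (nat₁ : v₁ ▷ X' ≫ b.hom = (λ_ X').hom ≫ (ρ_ X').inv ≫ X' ◁ v₁)
    (nat₂ : v₂ ▷ X' ≫ b.hom = (λ_ X').hom ≫ (ρ_ X').inv ≫ X' ◁ v₂) :
    (v₀ ⊗ₘ (p ⊗ₘ q)) ≫ (α_ _ _ _).inv ≫ mX ▷ Y' ≫ b.hom ▷ Y' ≫ (α_ _ _ _).hom ≫ X' ◁ mY ≫
      (α_ _ _ _).inv ≫ b.inv ▷ Y' ≫ (α_ _ _ _).hom = v₂ ⊗ₘ (p ⊗ₘ q) := by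
  have h1 : (v₀ ⊗ₘ (p ⊗ₘ q)) ≫ (α_ _ _ _).inv ≫ mX ▷ Y' =
      (α_ _ _ _).inv ≫ (v₁ ⊗ₘ p) ▷ Y ≫ (A ⊗ X') ◁ q := by
    have : (v₀ ⊗ₘ (p ⊗ₘ q)) ≫ (α_ _ _ _).inv ≫ mX ▷ Y' =
      (α_ _ _ _).inv ≫ ((v₀ ⊗ₘ p) ≫ mX) ▷ Y ≫ (A ⊗ X') ◁ q := by
      rw [associator_inv_naturality_assoc, ← tensorHom_id, ← tensorHom_id, ← id_tensorHom,
        tensorHom_comp_tensorHom, tensorHom_comp_tensorHom]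
      simp
    rw [this, hX]
  have h2 : (α_ _ _ _).inv ≫ (v₁ ⊗ₘ p) ▷ Y ≫ (A ⊗ X') ◁ q ≫ b.hom ▷ Y' ≫ (α_ _ _ _).hom =
      (λ_ _).hom ≫ p ▷ Y ≫ X' ◁ ((λ_ Y).inv ≫ (v₁ ⊗ₘ q)) := by
    rw [whisker_exchange_assoc, ← comp_whiskerRight_assoc, MonoidalCategory.tensorHom_def',
      Category.assoc, nat₁]
    simp only [MonoidalCategory.tensorHom_def]
    monoidal
  have h3 : (v₂ ⊗ₘ (p ⊗ₘ q)) ≫ (α_ _ _ _).inv ≫ b.hom ▷ Y' ≫ (α_ _ _ _).hom =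
      (λ_ _).hom ≫ p ▷ Y ≫ X' ◁ ((λ_ Y).inv ≫ (v₂ ⊗ₘ q)) := by
    have : (v₂ ⊗ₘ (p ⊗ₘ q)) ≫ (α_ _ _ _).inv ≫ b.hom ▷ Y' ≫ (α_ _ _ _).hom =
      𝟙_ D ◁ (p ⊗ₘ q) ≫ (α_ _ _ _).inv ≫ (v₂ ▷ X' ≫ b.hom) ▷ Y' ≫ (α_ _ _ _).hom := by
      simp only [MonoidalCategory.tensorHom_def']
      monoidal
    rw [this, nat₂, MonoidalCategory.tensorHom_def p q, MonoidalCategory.tensorHom_def' v₂ q]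
    monoidal
  rw [reassoc_of% h1, reassoc_of% h2, ← whiskerLeft_comp_assoc, Category.assoc, hY,
    ← reassoc_of% h3]
  simp

/-- Two successive passages around `X` are merged into one passage of `A ⊗ A`. The copoint `u₂` can
be delayed to the end because it slides past `X` through `b`. -/
lemma component_comp_component {A X : D} (v₀ : 𝟙_ D ⟶ A) (u₁ u₂ : A ⟶ 𝟙_ D) (b : A ⊗ X ≅ X ⊗ A)
    (m : A ⊗ X ⟶ A ⊗ X) (nat₂ : b.hom ≫ X ◁ u₂ = u₂ ▷ X ≫ (λ_ X).hom ≫ (ρ_ X).inv) :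
    ((λ_ X).inv ≫ v₀ ▷ X ≫ m ≫ u₂ ▷ X ≫ (λ_ X).hom) ≫
      ((λ_ X).inv ≫ v₀ ▷ X ≫ m ≫ u₁ ▷ X ≫ (λ_ X).hom) =
    (λ_ X).inv ≫ ((λ_ (𝟙_ D)).inv ≫ (v₀ ⊗ₘ v₀)) ▷ X ≫ ((α_ _ _ _).hom ≫ A ◁ m ≫ A ◁ b.hom ≫
      (α_ _ _ _).inv ≫ m ▷ A ≫ (α_ _ _ _).hom ≫ A ◁ b.inv ≫ (α_ _ _ _).inv) ≫
      ((u₁ ⊗ₘ u₂) ≫ (λ_ (𝟙_ D)).hom) ▷ X ≫ (λ_ X).hom := by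
  have n' : b.inv ≫ u₂ ▷ X = X ◁ u₂ ≫ (ρ_ X).hom ≫ (λ_ X).inv := by
    rw [Iso.inv_comp_eq, reassoc_of% nat₂]; simp
  have h1 : A ◁ b.inv ≫ (α_ _ _ _).inv ≫ ((u₁ ⊗ₘ u₂) ≫ (λ_ (𝟙_ D)).hom) ▷ X ≫ (λ_ X).hom =
      A ◁ (b.inv ≫ u₂ ▷ X ≫ (λ_ X).hom) ≫ u₁ ▷ X ≫ (λ_ X).hom := by
    simp only [MonoidalCategory.tensorHom_def']
    monoidal
  have h2 : (α_ A X A).inv ≫ m ▷ A ≫ (α_ _ _ _).hom ≫ A ◁ X ◁ u₂ =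
      A ◁ X ◁ u₂ ≫ (α_ _ _ _).inv ≫ m ▷ _ ≫ (α_ _ _ _).hom := by
    rw [← associator_naturality_right, ← whisker_exchange_assoc, associator_inv_naturality_right_assoc]
  simp only [Category.assoc]
  rw [h1, reassoc_of% n', whiskerLeft_comp_assoc, reassoc_of% h2, ← whiskerLeft_comp_assoc A b.hom,
    nat₂]
  have h3 : (λ_ X).inv ≫ ((λ_ (𝟙_ D)).inv ≫ (v₀ ⊗ₘ v₀)) ▷ X ≫ (α_ _ _ _).hom ≫ A ◁ m =
      (λ_ X).inv ≫ v₀ ▷ X ≫ m ≫ (λ_ _).inv ≫ v₀ ▷ _ := by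
    simp only [MonoidalCategory.tensorHom_def]
    have : (λ_ X).inv ≫ ((λ_ (𝟙_ D)).inv ≫ v₀ ▷ 𝟙_ D ≫ A ◁ v₀) ▷ X ≫ (α_ A A X).hom ≫ A ◁ m =
      (λ_ X).inv ≫ (λ_ _).inv ≫ v₀ ▷ (𝟙_ D ⊗ X) ≫ A ◁ v₀ ▷ X ≫ A ◁ m := by monoidal
    rw [this, ← whisker_exchange_assoc, ← whisker_exchange]
    monoidal
  rw [reassoc_of% h3]
  rw [whiskerLeft_comp_assoc A (u₂ ▷ X), ← whisker_exchange_assoc v₀ (u₂ ▷ X)]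
  monoidal

end Abstract

/-! ### The inverse monodromy in `C ⋊₀ S` and graded morphisms -/

namespace PreGalois

variable {C : Type u} [Category.{v} C] [MonoidalCategory C] [BraidedCategory C]
  {Γ : C} [ComonObj Γ] [IsCommComonObj Γ]

lemma whiskerLeft_hom (X : PreGalois Γ) {Z T : PreGalois Γ} (t : Z ⟶ T) :
    Hom.hom (X ◁ t) =
      (α_ Γ X.of Z.of).inv ≫ (β_ Γ X.of).hom ▷ Z.of ≫ (α_ _ _ _).hom ≫ X.of ◁ t.hom := rfl

lemma whiskerRight_hom {X Y : PreGalois Γ} (s : X ⟶ Y) (Z : PreGalois Γ) :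
    Hom.hom (s ▷ Z) = (α_ Γ X.of Z.of).inv ≫ s.hom ▷ Z.of := rfl

lemma inc_whiskerRight {X Y : C} (f : X ⟶ Y) (Z : PreGalois Γ) :
    inc f ▷ Z = inc (f ▷ Z.of) := wR_inc f Z

lemma whiskerLeft_inc (X : PreGalois Γ) {Y Z : C} (f : Y ⟶ Z) :
    X ◁ inc f = inc (X.of ◁ f) := wL_inc X f

variable (Γ) in
/-- The inverse monodromy of `Γ` and `X`, as a morphism of `C ⋊₀ S`. -/
def monodromy (X : PreGalois Γ) : (⟨Γ⟩ : PreGalois Γ) ⊗ X ⟶ (⟨Γ⟩ : PreGalois Γ) ⊗ X :=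
  inc ((β_ X.of Γ).inv ≫ (β_ Γ X.of).inv)

/-- A morphism `f : Γ ⟶ Γ` of `C`, seen as a morphism from the unit to `Γ` in `C ⋊₀ S`. -/
def point (f : Γ ⟶ Γ) : 𝟙_ (PreGalois Γ) ⟶ (⟨Γ⟩ : PreGalois Γ) := ⟨(ρ_ Γ).hom ≫ f⟩

lemma point_comp_inc (f g : Γ ⟶ Γ) : point f ≫ inc g = point (f ≫ g) := by
  ext
  rw [comp_inc_hom]
  simp [point]

lemma point_id_comp {X : C} (d : (⟨Γ⟩ : PreGalois Γ) ⟶ ⟨X⟩) :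
    Hom.hom (point (𝟙 Γ) ≫ d) = (ρ_ Γ).hom ≫ Δ[Γ] ≫ d.hom := by
  rw [comp_hom]
  change Δ[Γ] ▷ 𝟙_ C ≫ (α_ Γ Γ (𝟙_ C)).hom ≫ Γ ◁ ((ρ_ Γ).hom ≫ 𝟙 Γ) ≫ d.hom = _
  monoidal

lemma inc_whiskerRight_comp_monodromy (f : Γ ⟶ Γ) (X : PreGalois Γ) :
    inc f ▷ X ≫ monodromy Γ X = monodromy Γ X ≫ inc f ▷ X := by
  rw [monodromy, inc_whiskerRight]
  refine (inc_comp _ _).symm.trans (Eq.trans ?_ (inc_comp _ _))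
  congr 1
  rw [BraidedCategory.braiding_inv_naturality_left_assoc,
    BraidedCategory.braiding_inv_naturality_right, Category.assoc]

/-- The braiding `c_{V,X}` is natural in `V` with respect to all morphisms of `C ⋊₀ S`. -/
lemma whiskerRight_comp_braiding {V W : PreGalois Γ} (t : V ⟶ W) (X : PreGalois Γ) :
    t ▷ X ≫ (incIso (β_ W.of X.of)).hom =
      (show V ⊗ X ⟶ X ⊗ V from (incIso (β_ V.of X.of)).hom) ≫ X ◁ t := by
  ext
  refine (comp_inc_hom _ _).trans (Eq.trans ?_ (inc_comp_hom _ _).symm)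
  rw [whiskerLeft_hom, whiskerRight_hom, Category.assoc, BraidedCategory.braiding_naturality_left,
    BraidedCategory.braiding_tensor_left_hom]
  simp

/-- In `C` the morphism `t` has an extra `Γ`-leg. Naturality of the braiding therefore leaves behind
the monodromy of `Γ` with this leg, and `symm` removes it. -/
lemma whiskerLeft_comp_monodromy (symm : (β_ Γ Γ).hom ≫ (β_ Γ Γ).hom = 𝟙 _)
    {X Y : PreGalois Γ} (t : X ⟶ Y) :
    (⟨Γ⟩ : PreGalois Γ) ◁ t ≫ monodromy Γ Y = monodromy Γ X ≫ (⟨Γ⟩ : PreGalois Γ) ◁ t := by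
  ext
  refine (comp_inc_hom _ _).trans (Eq.trans ?_ (inc_comp_hom _ _).symm)
  have hs : (β_ Γ Γ).inv = (β_ Γ Γ).hom := by
    rw [← cancel_epi (β_ Γ Γ).hom, symm, Iso.hom_inv_id]
  rw [whiskerLeft_hom]
  simp only [Category.assoc]
  rw [BraidedCategory.braiding_inv_naturality_right_assoc,
    BraidedCategory.braiding_inv_naturality_left,
    BraidedCategory.braiding_tensor_left_inv, BraidedCategory.braiding_tensor_right_inv]
  simp only [Category.assoc, Iso.hom_inv_id_assoc, Iso.inv_hom_id_assoc,
    hs]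
  rw [← comp_whiskerRight_assoc, symm]
  simp

lemma braiding_unit_left (X : PreGalois Γ) :
    (show 𝟙_ (PreGalois Γ) ⊗ X ⟶ X ⊗ 𝟙_ (PreGalois Γ) from (incIso (β_ (𝟙_ C) X.of)).hom) =
      (λ_ X).hom ≫ (ρ_ X).inv := by
  change inc _ = inc _ ≫ inc _
  rw [← inc_comp, braiding_tensorUnit_left]

variable (Γ) in
/-- The braiding `c_{Γ,X}` as an isomorphism of `C ⋊₀ S`. -/
def braidingIso (X : PreGalois Γ) : (⟨Γ⟩ : PreGalois Γ) ⊗ X ≅ X ⊗ (⟨Γ⟩ : PreGalois Γ) :=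
  incIso (β_ Γ X.of)

lemma whiskerRight_comp_braidingIso (t : 𝟙_ (PreGalois Γ) ⟶ ⟨Γ⟩) (X : PreGalois Γ) :
    t ▷ X ≫ (braidingIso Γ X).hom = (λ_ X).hom ≫ (ρ_ X).inv ≫ X ◁ t := by
  refine (whiskerRight_comp_braiding t X).trans ?_
  rw [← Category.assoc, ← braiding_unit_left]
  rfl

lemma braidingIso_comp_whiskerLeft (t : (⟨Γ⟩ : PreGalois Γ) ⟶ 𝟙_ (PreGalois Γ))
    (X : PreGalois Γ) :
    (braidingIso Γ X).hom ≫ X ◁ t = t ▷ X ≫ (λ_ X).hom ≫ (ρ_ X).inv := by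
  refine (whiskerRight_comp_braiding t X).symm.trans ?_
  rw [← braiding_unit_left]
  rfl

/-- Both inverse braidings split by a hexagon; inserting `c_{Γ,X}` and its inverse brings the result
to the shape of `tensor_point_comp_monodromy`. -/
lemma monodromy_tensor (X Y : PreGalois Γ) :
    monodromy Γ (X ⊗ Y) = (α_ _ _ _).inv ≫ monodromy Γ X ▷ Y ≫ (braidingIso Γ X).hom ▷ Y ≫
      (α_ _ _ _).hom ≫ X ◁ monodromy Γ Y ≫ (α_ _ _ _).inv ≫ (braidingIso Γ X).inv ▷ Y ≫
      (α_ _ _ _).hom := by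
  change inc _ = inc _ ≫ wR (inc _) _ ≫ wR (inc _) _ ≫ inc _ ≫ wL _ (inc _) ≫ inc _ ≫
    wR (inc _) _ ≫ inc _
  simp only [wR_inc, wL_inc, ← inc_comp]
  congr 1
  change (β_ (X.of ⊗ Y.of) Γ).inv ≫ (β_ Γ (X.of ⊗ Y.of)).inv = _
  rw [BraidedCategory.braiding_tensor_left_inv, BraidedCategory.braiding_tensor_right_inv]
  simp

variable (Γ) in
/-- The comultiplication of `Γ` as a morphism of `C ⋊₀ S`. -/
def incComul : (⟨Γ⟩ : PreGalois Γ) ⟶ (⟨Γ⟩ : PreGalois Γ) ⊗ (⟨Γ⟩ : PreGalois Γ) := inc Δ[Γ]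

-- The hexagons in the other variable identify the bracket with the inverse monodromy of `Γ ⊗ Γ`
-- with `X`; naturality with respect to `Δ` does the rest.
variable (Γ) in
lemma monodromy_tensor_left (X : PreGalois Γ) :
    incComul Γ ▷ X ≫ ((α_ _ _ _).hom ≫ (⟨Γ⟩ : PreGalois Γ) ◁ monodromy Γ X ≫
      (⟨Γ⟩ : PreGalois Γ) ◁ (braidingIso Γ X).hom ≫ (α_ _ _ _).inv ≫
      monodromy Γ X ▷ (⟨Γ⟩ : PreGalois Γ) ≫ (α_ _ _ _).hom ≫
      (⟨Γ⟩ : PreGalois Γ) ◁ (braidingIso Γ X).inv ≫ (α_ _ _ _).inv) =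
    monodromy Γ X ≫ incComul Γ ▷ X := by
  change wR (inc _) _ ≫ inc _ ≫ wL _ (inc _) ≫ wL _ (inc _) ≫ inc _ ≫ wR (inc _) _ ≫ inc _ ≫
    wL _ (inc _) ≫ inc _ = inc _ ≫ wR (inc _) _
  simp only [wR_inc, wL_inc, ← inc_comp]
  congr 1
  simp only [Category.assoc]
  rw [← BraidedCategory.braiding_inv_naturality_right,
    ← BraidedCategory.braiding_inv_naturality_left_assoc,
    BraidedCategory.braiding_tensor_left_inv, BraidedCategory.braiding_tensor_right_inv]
  simp

/-- The point of the identity is grouplike: the tensor product of morphisms of `C ⋊₀ S` duplicates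
the `Γ`-leg by `Δ`. -/
lemma point_comp_comul :
    point (𝟙 Γ) ≫ incComul Γ =
      (λ_ (𝟙_ (PreGalois Γ))).inv ≫ (point (𝟙 Γ) ⊗ₘ point (𝟙 Γ)) := by
  ext
  refine (comp_inc_hom _ _).trans (Eq.trans ?_ (inc_comp_hom _ _).symm)
  change ((ρ_ Γ).hom ≫ 𝟙 Γ) ≫ Δ[Γ] = Γ ◁ (λ_ (𝟙_ C)).inv ≫ Δ[Γ] ▷ (𝟙_ C ⊗ 𝟙_ C) ≫
    tensorμ Γ Γ (𝟙_ C) (𝟙_ C) ≫ (((ρ_ Γ).hom ≫ 𝟙 Γ) ⊗ₘ ((ρ_ Γ).hom ≫ 𝟙 Γ))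
  simp only [tensorμ, braiding_tensorUnit_right]
  monoidal

/-- The morphism `p` of `C ⋊₀ S` has grade `f`. -/
def IsGraded (f : Γ ⟶ Γ) {X Y : PreGalois Γ} (p : X ⟶ Y) : Prop :=
  (point (𝟙 Γ) ⊗ₘ p) ≫ monodromy Γ Y = point f ⊗ₘ p

/-- Every point is the identity point followed by a morphism of `C`, and such morphisms commute with
the monodromy. So the grade controls the monodromy at all points. -/
lemma IsGraded.point_tensor {f : Γ ⟶ Γ} {X Y : PreGalois Γ} {p : X ⟶ Y} (h : IsGraded f p)
    (g : Γ ⟶ Γ) : (point g ⊗ₘ p) ≫ monodromy Γ Y = point (f ≫ g) ⊗ₘ p := by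
  have h1 : ∀ k, (point (k ≫ g) ⊗ₘ p) = (point k ⊗ₘ p) ≫ inc g ▷ Y := by
    intro k
    rw [← point_comp_inc, ← tensorHom_id, tensorHom_comp_tensorHom, Category.comp_id]
  rw [h1, ← h, Category.assoc, ← inc_whiskerRight_comp_monodromy, ← Category.assoc, ← h1,
    Category.id_comp]

lemma IsGraded.comp_left {f : Γ ⟶ Γ} {X Y Z : PreGalois Γ} {p : Y ⟶ Z} (h : IsGraded f p)
    (s : X ⟶ Y) : IsGraded f (s ≫ p) := by
  have h1 : ∀ k : Γ ⟶ Γ, (point k ⊗ₘ (s ≫ p)) = 𝟙_ _ ◁ s ≫ (point k ⊗ₘ p) := by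
    intro k
    rw [← id_tensorHom, tensorHom_comp_tensorHom, Category.id_comp]
  unfold IsGraded at *
  rw [h1, h1, Category.assoc, h]

lemma IsGraded.comp_right (symm : (β_ Γ Γ).hom ≫ (β_ Γ Γ).hom = 𝟙 _)
    {f : Γ ⟶ Γ} {X Y Z : PreGalois Γ} {p : X ⟶ Y} (h : IsGraded f p)
    (s : Y ⟶ Z) : IsGraded f (p ≫ s) := by
  have h1 : ∀ k : Γ ⟶ Γ, (point k ⊗ₘ (p ≫ s)) = (point k ⊗ₘ p) ≫ (⟨Γ⟩ : PreGalois Γ) ◁ s := by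
    intro k
    rw [← id_tensorHom, tensorHom_comp_tensorHom, Category.comp_id]
  unfold IsGraded at *
  rw [h1, h1, Category.assoc, whiskerLeft_comp_monodromy symm, reassoc_of% h]

/-- Passing `p` produces the point `f`; passing `q` from there produces `g ≫ f`, that is `f ∘ g`, so
the order agrees with the product of `Aut(Γ)`. -/
lemma IsGraded.tensor {f g : Γ ⟶ Γ} {X X' Y Y' : PreGalois Γ} {p : X ⟶ X'} {q : Y ⟶ Y'}
    (hp : IsGraded f p) (hq : IsGraded g q) : IsGraded (g ≫ f) (p ⊗ₘ q) := by
  unfold IsGraded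
  rw [monodromy_tensor]
  exact tensor_point_comp_monodromy (braidingIso Γ X') hp (hq.point_tensor f)
    (whiskerRight_comp_braidingIso _ _) (whiskerRight_comp_braidingIso _ _)

lemma isGraded_unit {X : PreGalois Γ} (p : X ⟶ 𝟙_ (PreGalois Γ)) : IsGraded (𝟙 Γ) p := by
  have : monodromy Γ (𝟙_ (PreGalois Γ)) = 𝟙 _ := by
    refine Eq.trans ?_ (inc_id _)
    change inc ((β_ (𝟙_ C) Γ).inv ≫ (β_ Γ (𝟙_ C)).inv) = inc _
    congr 1
    rw [braiding_inv_tensorUnit_left, braiding_inv_tensorUnit_right]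
    simp
    rfl
  unfold IsGraded
  rw [this, Category.comp_id]

end PreGalois
end

noncomputable section

open scoped ComonObj MonObj TensorProduct

/-! ### Splitting of `Γ` by its automorphisms and the component projections -/

namespace GaloisGroup
variable {C : Type u} [Category.{v} C] [MonoidalCategory C] {Γ : C} [MonObj Γ]

lemma toHom_one : (1 : GaloisGroup Γ).toHom = 𝟙 Γ := rfl

lemma toHom_mul (g h : GaloisGroup Γ) : (g * h).toHom = h.toHom ≫ g.toHom := rfl

lemma toHom_inv_comp (g : GaloisGroup Γ) : (g⁻¹).toHom ≫ g.toHom = 𝟙 Γ := by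
  rw [← toHom_mul, mul_inv_cancel, toHom_one]

end GaloisGroup

/-- The properties of the regular algebra `Γ` on which the construction of the crossed category
`C ⋊ S` rests: it is a special Frobenius algebra with trivial self-monodromy, which is
"trivialized" by its automorphism group. -/
structure IsGaloisObject (F : Type w) [Field F] {C : Type u} [Category.{v} C] [Preadditive C]
    [Linear F C] [MonoidalCategory C] [BraidedCategory C] (Γ : C) [MonObj Γ] [ComonObj Γ]
    [Fintype (GaloisGroup Γ)] : Prop where
  symm : (β_ Γ Γ).hom ≫ (β_ Γ Γ).hom = 𝟙 _
  comul_mul_counit : Δ[Γ] ▷ Γ ≫ (α_ _ _ _).hom ≫ Γ ◁ (μ[Γ] ≫ ε[Γ]) ≫ (ρ_ Γ).hom = μ[Γ]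
  mul_comul : μ[Γ] ≫ Δ[Γ] = Γ ◁ Δ[Γ] ≫ (α_ _ _ _).inv ≫ μ[Γ] ▷ Γ
  comul_mul : Δ[Γ] ≫ μ[Γ] = (Fintype.card (GaloisGroup Γ) : F) • 𝟙 Γ
  aut_comul (g : GaloisGroup Γ) : g.toHom ≫ Δ[Γ] = Δ[Γ] ≫ (g.toHom ⊗ₘ g.toHom)
  aut_counit (g : GaloisGroup Γ) : g.toHom ≫ ε[Γ] = ε[Γ]
  comul_aut_mul_counit (g : GaloisGroup Γ) (hg : g ≠ 1) :
    Δ[Γ] ≫ Γ ◁ g.toHom ≫ μ[Γ] ≫ ε[Γ] = 0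
  sum_aut : ∑ g : GaloisGroup Γ, Γ ◁ (g⁻¹).toHom ≫ μ[Γ] ≫ g.toHom =
    (Fintype.card (GaloisGroup Γ) : F) • (ε[Γ] ▷ Γ ≫ (λ_ Γ).hom)
  exists_smul_counit (f : Γ ⟶ 𝟙_ C) : ∃ c : F, f = c • ε[Γ]
  counit_ne_zero : ε[Γ] ≠ 0

namespace PreGalois

section Linear

variable {C : Type u} [Category.{v} C] [MonoidalCategory C] [Preadditive C] [MonoidalPreadditive C]
  {Γ : C} [ComonObj Γ]

lemma add_hom {X Y : PreGalois Γ} (s t : X ⟶ Y) : (s + t).hom = s.hom + t.hom := rfl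

lemma zero_hom {X Y : PreGalois Γ} : (0 : X ⟶ Y).hom = 0 := rfl

lemma sum_hom {X Y : PreGalois Γ} {J : Type*} (s : Finset J) (f : J → (X ⟶ Y)) :
    (∑ i ∈ s, f i).hom = ∑ i ∈ s, (f i).hom :=
  map_sum (⟨⟨Hom.hom, zero_hom⟩, add_hom⟩ : (X ⟶ Y) →+ (Γ ⊗ X.of ⟶ Y.of)) f s

instance (F : Type w) [Field F] [Linear F C] [MonoidalLinear F C] : Linear F (PreGalois Γ) where
  homModule X Y := (homEquiv X Y).module F
  smul_comp X Y Z r s t := by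
    ext
    change _ = r • Hom.hom (s ≫ t)
    simp only [comp_hom]
    change Δ[Γ] ▷ X.of ≫ (α_ Γ Γ X.of).hom ≫ Γ ◁ (r • s.hom) ≫ t.hom = _
    simp
  comp_smul X Y Z s r t := by
    ext
    change _ = r • Hom.hom (s ≫ t)
    simp only [comp_hom]
    change Δ[Γ] ▷ X.of ≫ (α_ Γ Γ X.of).hom ≫ Γ ◁ s.hom ≫ (r • t.hom) = _
    simp

lemma smul_hom {F : Type w} [Field F] [Linear F C] [MonoidalLinear F C] {X Y : PreGalois Γ}
    (r : F) (s : X ⟶ Y) : (r • s).hom = r • s.hom := rfl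

instance [BraidedCategory C] [IsCommComonObj Γ] : MonoidalPreadditive (PreGalois Γ) where
  whiskerLeft_zero {X Y Z} := by
    ext
    rw [whiskerLeft_hom, zero_hom]
    simp [zero_hom]
  zero_whiskerRight {X Y Z} := by
    ext
    rw [whiskerRight_hom, zero_hom]
    simp [zero_hom]
  whiskerLeft_add {X Y Z} s t := by
    ext
    simp only [whiskerLeft_hom, add_hom]
    simp
  add_whiskerRight {X Y Z} s t := by
    ext
    simp only [whiskerRight_hom, add_hom]
    simp

end Linear

variable {F : Type w} [Field F] {C : Type u} [Category.{v} C] [Preadditive C]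
  [Linear F C] [MonoidalCategory C] [MonoidalPreadditive C] [MonoidalLinear F C]
  [BraidedCategory C] {Γ : C} [MonObj Γ] [ComonObj Γ] [IsCommComonObj Γ]

lemma IsGraded.sum {f : Γ ⟶ Γ} {X Y : PreGalois Γ} {J : Type*} {s : Finset J}
    {p : J → (X ⟶ Y)} (h : ∀ i ∈ s, IsGraded f (p i)) : IsGraded f (∑ i ∈ s, p i) := by
  unfold IsGraded
  rw [tensor_sum, tensor_sum, Preadditive.sum_comp]
  exact Finset.sum_congr rfl h

lemma inc_tensorHom {X Y X' Y' : C} (f : X ⟶ Y) (g : X' ⟶ Y') :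
    inc (Γ := Γ) (f ⊗ₘ g) = inc f ⊗ₘ inc g := by
  rw [MonoidalCategory.tensorHom_def, MonoidalCategory.tensorHom_def, inc_whiskerRight,
    whiskerLeft_inc]
  exact inc_comp _ _

lemma point_comp_hom {X : C} (f : Γ ⟶ Γ) (d : (⟨Γ⟩ : PreGalois Γ) ⟶ ⟨X⟩) :
    Hom.hom (point f ≫ d) = (ρ_ Γ).hom ≫ Δ[Γ] ≫ Γ ◁ f ≫ d.hom := by
  rw [← Category.id_comp f, ← point_comp_inc, Category.assoc, point_id_comp, inc_comp_hom,
    Category.id_comp]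

variable [Fintype (GaloisGroup Γ)] [DecidableEq (GaloisGroup Γ)]

variable (F) in
/-- The morphisms from `Γ` to the unit in `C ⋊₀ S` dual to the points given by `Aut(Γ)`. -/
def copoint (g : GaloisGroup Γ) : (⟨Γ⟩ : PreGalois Γ) ⟶ 𝟙_ (PreGalois Γ) :=
  -- The factor compensates for `μ ∘ Δ` being multiplication by the group order.
  inc (g⁻¹).toHom ≫ ⟨(Fintype.card (GaloisGroup Γ) : F)⁻¹ • (μ[Γ] ≫ ε[Γ])⟩

variable [CharZero F]

/-- The pairing depends only on `h⁻¹ * g`: specialness gives the diagonal case, and the vanishing of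
`ε ∘ μ ∘ (id ⊗ x) ∘ Δ` for `x ≠ 1` gives the others. -/
lemma point_comp_copoint (H : IsGaloisObject F Γ) (g h : GaloisGroup Γ) :
    point g.toHom ≫ copoint F h = if g = h then 𝟙 _ else 0 := by
  have hn : (Fintype.card (GaloisGroup Γ) : F) ≠ 0 := by simp
  rw [copoint, ← Category.assoc, point_comp_inc, ← GaloisGroup.toHom_mul]
  ext
  refine (point_comp_hom _ _).trans ?_
  split_ifs with e
  · subst e
    have := H.comul_mul
    rw [inv_mul_cancel, GaloisGroup.toHom_one, whiskerLeft_id, Category.id_comp, Linear.comp_smul,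
      reassoc_of% this, Linear.smul_comp, smul_smul, inv_mul_cancel₀ hn, one_smul, id_hom]
    change _ = ε[Γ] ▷ (𝟙_ C) ≫ (λ_ (𝟙_ C)).hom
    monoidal
  · have := H.comul_aut_mul_counit (h⁻¹ * g) (by rwa [ne_eq, inv_mul_eq_one, eq_comm])
    rw [Linear.comp_smul, Linear.comp_smul, this]
    simp [zero_hom]

/-- The Frobenius relation `comul_mul_counit` turns each summand into a term of `sum_aut`. With
`point_comp_copoint` this makes `Γ` a direct sum of units. -/
lemma sum_copoint_comp_point (H : IsGaloisObject F Γ) :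
    ∑ g : GaloisGroup Γ, copoint F g ≫ point g.toHom = 𝟙 (⟨Γ⟩ : PreGalois Γ) := by
  have hn : (Fintype.card (GaloisGroup Γ) : F) ≠ 0 := by simp
  ext
  rw [sum_hom]
  have key : ∀ g : GaloisGroup Γ, Hom.hom (copoint F g ≫ point g.toHom) =
      (Fintype.card (GaloisGroup Γ) : F)⁻¹ • (Γ ◁ (g⁻¹).toHom ≫ μ[Γ] ≫ g.toHom) := by
    intro g
    have h1 := H.comul_mul_counit
    rw [copoint, Category.assoc, inc_comp_hom, comp_hom]
    change Γ ◁ _ ≫ Δ[Γ] ▷ Γ ≫ (α_ Γ Γ Γ).hom ≫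
      Γ ◁ ((Fintype.card (GaloisGroup Γ) : F)⁻¹ • (μ[Γ] ≫ ε[Γ])) ≫ (ρ_ Γ).hom ≫ g.toHom = _
    rw [MonoidalLinear.whiskerLeft_smul]
    simp only [Linear.comp_smul, Linear.smul_comp]
    rw [reassoc_of% h1]
  simp only [key]
  rw [← Finset.smul_sum, H.sum_aut, smul_smul, inv_mul_cancel₀ hn, one_smul, id_hom]

/-- Automorphisms preserve `Δ`, so all their points are grouplike; the dual copoints then multiply
as orthogonal idempotents. This is read off after inserting the decomposition of `𝟙 Γ`. -/
lemma comul_comp_copoint (H : IsGaloisObject F Γ) (g h : GaloisGroup Γ) :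
    incComul Γ ≫
      (copoint F g ⊗ₘ copoint F h) ≫ (λ_ (𝟙_ (PreGalois Γ))).hom =
        if g = h then copoint F g else 0 := by
  have h1 : ∀ x : GaloisGroup Γ, point x.toHom ≫
      incComul Γ =
      (λ_ (𝟙_ (PreGalois Γ))).inv ≫ (point x.toHom ⊗ₘ point x.toHom) := by
    intro x
    have h2 := point_comp_comul (Γ := Γ)
    have h3 : inc (Γ := Γ) x.toHom ≫
        incComul Γ =
        incComul Γ ≫
          (inc x.toHom ⊗ₘ inc x.toHom) := by
      rw [← inc_tensorHom]
      refine (inc_comp _ _).symm.trans (Eq.trans ?_ (inc_comp _ _))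
      rw [H.aut_comul]
    rw [← Category.id_comp x.toHom, ← point_comp_inc, Category.assoc, h3, ← Category.assoc]
    rw [h2]
    simp
  rw [← Category.id_comp (incComul Γ), ← sum_copoint_comp_point H]
  simp only [Preadditive.sum_comp, Category.assoc]
  have h4 : ∀ x : GaloisGroup Γ, copoint F x ≫ point x.toHom ≫
      incComul Γ ≫
      (copoint F g ⊗ₘ copoint F h) ≫ (λ_ (𝟙_ (PreGalois Γ))).hom =
      if x = g then (if x = h then copoint F x else 0) else 0 := by
    intro x
    rw [reassoc_of% (h1 x), tensorHom_comp_tensorHom_assoc, point_comp_copoint H,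
      point_comp_copoint H]
    split_ifs <;> simp
  rw [Finset.sum_congr rfl fun x _ => h4 x]
  simp

variable (F) in
/-- The projection of `X` onto its component of grade `g`. -/
def component (g : GaloisGroup Γ) (X : PreGalois Γ) : X ⟶ X :=
  (λ_ X).inv ≫ point (𝟙 Γ) ▷ X ≫ monodromy Γ X ≫ copoint F g ▷ X ≫ (λ_ X).hom

lemma component_naturality (H : IsGaloisObject F Γ) (g : GaloisGroup Γ) {X Y : PreGalois Γ}
    (s : X ⟶ Y) : s ≫ component F g Y = component F g X ≫ s := by
  simp only [component, Category.assoc]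
  rw [leftUnitor_inv_naturality_assoc, whisker_exchange_assoc,
    reassoc_of% whiskerLeft_comp_monodromy H.symm s, whisker_exchange_assoc, leftUnitor_naturality]

/-- The two points merge into the comultiplied identity point, `Δ` moves through the monodromy, and
the two copoints then meet `Δ`, where `comul_comp_copoint` applies. -/
lemma component_comp_component (H : IsGaloisObject F Γ) (g h : GaloisGroup Γ) (X : PreGalois Γ) :
    component F h X ≫ component F g X = if g = h then component F g X else 0 := by
  have h1 := monodromy_tensor_left Γ X
  refine (_root_.component_comp_component (point (𝟙 Γ)) (copoint F g) (copoint F h)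
    (braidingIso Γ X) (monodromy Γ X) (braidingIso_comp_whiskerLeft _ _)).trans ?_
  rw [← point_comp_comul, comp_whiskerRight_assoc, ← Category.assoc (incComul Γ ▷ X), h1,
    Category.assoc, ← comp_whiskerRight_assoc (incComul Γ), comul_comp_copoint H]
  split_ifs
  · rfl
  · simp

lemma sum_copoint (H : IsGaloisObject F Γ) :
    ∑ g : GaloisGroup Γ, copoint F g = (inc ε[Γ] : _ ⟶ 𝟙_ (PreGalois Γ)) := by
  have h1 : ∀ g : GaloisGroup Γ, point g.toHom ≫ (inc ε[Γ] : _ ⟶ 𝟙_ (PreGalois Γ)) = 𝟙 _ := by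
    intro g
    ext
    refine (comp_inc_hom _ _).trans ?_
    rw [point, Category.assoc, H.aut_counit]
    change (ρ_ Γ).hom ≫ ε[Γ] = ε[Γ] ▷ (𝟙_ C) ≫ (λ_ (𝟙_ C)).hom
    monoidal
  rw [← Category.id_comp (inc ε[Γ] : _ ⟶ 𝟙_ (PreGalois Γ)), ← sum_copoint_comp_point H,
    Preadditive.sum_comp]
  simp only [Category.assoc, h1, Category.comp_id]

/-- The copoints add up to `ε`, which reduces the monodromy to that of the unit. -/
lemma sum_component (H : IsGaloisObject F Γ) (X : PreGalois Γ) :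
    ∑ g : GaloisGroup Γ, component F g X = 𝟙 X := by
  have h1 : monodromy Γ X ≫ (inc ε[Γ] : _ ⟶ 𝟙_ (PreGalois Γ)) ▷ X =
      (inc ε[Γ] : _ ⟶ 𝟙_ (PreGalois Γ)) ▷ X := by
    change inc _ ≫ wR (inc _) _ = wR (inc _) _
    rw [wR_inc, ← inc_comp, Category.assoc]
    congr 1
    rw [← BraidedCategory.braiding_inv_naturality_right,
      ← BraidedCategory.braiding_inv_naturality_left_assoc, braiding_inv_tensorUnit_left,
      braiding_inv_tensorUnit_right]
    simp
  have h2 : point (𝟙 Γ) ≫ (inc ε[Γ] : _ ⟶ 𝟙_ (PreGalois Γ)) = 𝟙 _ := by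
    ext
    refine (comp_inc_hom _ _).trans ?_
    rw [point, Category.assoc, Category.id_comp]
    change (ρ_ Γ).hom ≫ ε[Γ] = ε[Γ] ▷ (𝟙_ C) ≫ (λ_ (𝟙_ C)).hom
    monoidal
  simp only [component]
  rw [← Preadditive.comp_sum, ← Preadditive.comp_sum, ← Preadditive.comp_sum,
    ← Preadditive.sum_comp, ← sum_whiskerRight, sum_copoint H, reassoc_of% h1,
    ← comp_whiskerRight_assoc, h2]
  simp

/-- Expanding the outgoing `Γ` in points, the coefficient of the point `x` is `p` followed by its
component at `x`, which vanishes for `x ≠ g`. -/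
lemma isGraded_of_comp_component (H : IsGaloisObject F Γ) {g : GaloisGroup Γ} {X Y : PreGalois Γ}
    {p : X ⟶ Y} (h : p ≫ component F g Y = p) : IsGraded g.toHom p := by
  have h1 : ∀ x : GaloisGroup Γ, (point (𝟙 Γ) ⊗ₘ p) ≫ monodromy Γ Y ≫ copoint F x ▷ Y =
      if x = g then (𝟙_ (PreGalois Γ)) ◁ p else 0 := by
    intro x
    have h2 : point (𝟙 Γ) ▷ Y ≫ monodromy Γ Y ≫ copoint F x ▷ Y =
        (λ_ Y).hom ≫ component F x Y ≫ (λ_ Y).inv := by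
      simp [component]
    rw [MonoidalCategory.tensorHom_def', Category.assoc, h2, leftUnitor_naturality_assoc, ← h,
      Category.assoc, reassoc_of% component_comp_component H x g Y]
    split_ifs with e
    · subst e
      simp
    · simp
  have h3 : (point (𝟙 Γ) ⊗ₘ p) ≫ monodromy Γ Y =
      ∑ x : GaloisGroup Γ, (point (𝟙 Γ) ⊗ₘ p) ≫ monodromy Γ Y ≫
        (copoint F x ≫ point x.toHom) ▷ Y := by
    rw [← Preadditive.comp_sum, ← Preadditive.comp_sum, ← sum_whiskerRight,
      sum_copoint_comp_point H]
    simp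
  unfold IsGraded
  rw [h3]
  simp only [comp_whiskerRight]
  rw [Finset.sum_eq_single g, reassoc_of% h1, if_pos rfl, ← MonoidalCategory.tensorHom_def']
  · intro x _ hx
    rw [reassoc_of% h1, if_neg hx]
    simp
  · simp

/-- Distinct points are separated by a copoint, which would leave `p = 0`. -/
lemma eq_of_isGraded (H : IsGaloisObject F Γ) {g h : GaloisGroup Γ} {X Y : PreGalois Γ}
    {p : X ⟶ Y} (hp : p ≠ 0) (hg : IsGraded g.toHom p) (hh : IsGraded h.toHom p) : g = h := by
  by_contra e
  have h1 : point g.toHom ⊗ₘ p = point h.toHom ⊗ₘ p := hg.symm.trans hh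
  have h2 := congrArg (· ≫ copoint F g ▷ Y) h1
  simp only [← tensorHom_id, tensorHom_comp_tensorHom, point_comp_copoint H, if_true,
    if_neg (Ne.symm e)] at h2
  apply hp
  rw [id_tensorHom, Category.comp_id, MonoidalPreadditive.zero_tensor] at h2
  have h3 := leftUnitor_naturality p
  rw [h2, zero_comp, eq_comm] at h3
  rwa [← cancel_epi (λ_ X).hom, comp_zero]

/-- `∂' ∘ Δ` is the value of `∂'` at the identity point, so the definition of `∂` through `∂'` and
the grading by points carry the same information. -/
lemma isDegree_iff (H : IsGaloisObject F Γ) (P : GaloisCat Γ) (g : GaloisGroup Γ) :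
    IsDegree Γ P g.toHom ↔ IsGraded g.toHom P.p := by
  constructor
  · rintro ⟨d, h, hd⟩
    have h1 : point (𝟙 Γ) ≫ d = point g.toHom := by
      ext
      rw [point_id_comp, hd]
      rfl
    unfold IsGraded
    rw [← h1, ← Category.id_comp P.p, ← tensorHom_comp_tensorHom, ← h, Category.id_comp,
      MonoidalCategory.tensorHom_def, tensorHom_id, Category.assoc]
    rfl
  · intro h
    have hc : ∀ x : GaloisGroup Γ, (point x.toHom ⊗ₘ P.p) ≫ monodromy Γ P.X =
      point (g.toHom ≫ x.toHom) ⊗ₘ P.p := fun x => h.point_tensor _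
    -- As `Γ` is the sum of its points, `∂'` is prescribed by its value at each point `x`, as
    -- dictated by `IsGraded.point_tensor`; the term `x = 1` recovers `g`.
    refine ⟨∑ x : GaloisGroup Γ, copoint F x ≫ point (g.toHom ≫ x.toHom), ?_, ?_⟩
    · change _ ≫ monodromy Γ P.X = _
      rw [← id_tensorHom, ← sum_copoint_comp_point H, sum_tensor, sum_tensor, Preadditive.sum_comp]
      refine Finset.sum_congr rfl fun x _ => ?_
      rw [← Category.id_comp P.p, ← tensorHom_comp_tensorHom, Category.assoc, hc,
        tensorHom_comp_tensorHom, Category.id_comp]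
    · apply (cancel_epi (ρ_ Γ).hom).1
      rw [← point_id_comp, Preadditive.comp_sum, Finset.sum_eq_single 1]
      · rw [← Category.assoc, ← GaloisGroup.toHom_one, point_comp_copoint H, if_pos rfl,
          Category.id_comp, GaloisGroup.toHom_one, Category.comp_id]
        rfl
      · intro x _ hx
        rw [← Category.assoc, ← GaloisGroup.toHom_one, point_comp_copoint H, if_neg (Ne.symm hx),
          zero_comp]
      · simp

end PreGalois
end

noncomputable section

open scoped ComonObj MonObj TensorProduct

/-! ### Strictness -/

section Strict

lemma karoubi_mk_eq {D : Type u} [Category.{v} D] {X : D} {p q : X ⟶ X} (hp : p ≫ p = p)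
    (hq : q ≫ q = q) (h : p = q) : Karoubi.mk X p hp = Karoubi.mk X q hq := by
  subst h
  rfl

/-- The identity of `(X, p)` is `p` itself, so transport along equal objects shows up as an
idempotent that can be absorbed. -/
lemma karoubi_eqToHom_f {D : Type u} [Category.{v} D] {X : D} {p q : X ⟶ X} (hp : p ≫ p = p)
    (hq : q ≫ q = q) (h : Karoubi.mk X p hp = Karoubi.mk X q hq) :
    Karoubi.Hom.f (eqToHom h) = p := by
  rw [Karoubi.eqToHom_f]
  simp

/-- The required equality of idempotents is naturality of the constraint isomorphisms, read through
`eqToHom`. -/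
lemma IsStrictTensorCat.karoubi {D : Type u} [Category.{v} D] [MonoidalCategory D]
    (h : IsStrictTensorCat D) : IsStrictTensorCat (Karoubi D) where
  assoc P Q R := by
    obtain ⟨e, he⟩ := h.assoc P.X Q.X R.X
    have e' : (P ⊗ Q) ⊗ R = P ⊗ (Q ⊗ R) := by
      refine Karoubi.ext e ?_
      rw [← he]
      exact associator_naturality _ _ _
    refine ⟨e', ?_⟩
    ext
    rw [Karoubi.eqToHom_f, ← he]
    rfl
  unit_left P := by
    obtain ⟨e, he⟩ := h.unit_left P.X
    have e' : 𝟙_ _ ⊗ P = P := by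
      refine Karoubi.ext e ?_
      rw [← he]
      exact (congrArg (· ≫ _) (id_tensorHom _ _)).trans (leftUnitor_naturality _)
    refine ⟨e', ?_⟩
    ext
    rw [Karoubi.eqToHom_f, ← he]
    rfl
  unit_right P := by
    obtain ⟨e, he⟩ := h.unit_right P.X
    have e' : P ⊗ 𝟙_ _ = P := by
      refine Karoubi.ext e ?_
      rw [← he]
      exact (congrArg (· ≫ _) (tensorHom_id _ _)).trans (rightUnitor_naturality _)
    refine ⟨e', ?_⟩
    ext
    rw [Karoubi.eqToHom_f, ← he]
    rfl

variable {C : Type u} [Category.{v} C] [MonoidalCategory C] [BraidedCategory C]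
  {Γ : C} [ComonObj Γ] [IsCommComonObj Γ]

lemma PreGalois.inc_eqToHom {X Y : C} (e : X = Y) :
    PreGalois.inc (Γ := Γ) (eqToHom e) = eqToHom (congrArg PreGalois.mk e) := by
  subst e
  exact PreGalois.inc_id X

lemma IsStrictTensorCat.preGalois (h : IsStrictTensorCat C) :
    IsStrictTensorCat (PreGalois Γ) where
  assoc X Y Z := by
    obtain ⟨e, he⟩ := h.assoc X.of Y.of Z.of
    exact ⟨congrArg PreGalois.mk e, (congrArg PreGalois.inc he).trans (PreGalois.inc_eqToHom e)⟩
  unit_left X := by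
    obtain ⟨e, he⟩ := h.unit_left X.of
    exact ⟨congrArg PreGalois.mk e, (congrArg PreGalois.inc he).trans (PreGalois.inc_eqToHom e)⟩
  unit_right X := by
    obtain ⟨e, he⟩ := h.unit_right X.of
    exact ⟨congrArg PreGalois.mk e, (congrArg PreGalois.inc he).trans (PreGalois.inc_eqToHom e)⟩

end Strict

/-! ### Strict tensor functors induced on the idempotent completion -/

section Twist

/-- A map on the morphisms of a tensor category which preserves the whole structure; in other
words, a strict tensor functor which is the identity on objects. -/
structure Twist (D : Type u) [Category.{v} D] [MonoidalCategory D] where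
  /-- the map on morphisms -/
  map : ∀ {X Y : D}, (X ⟶ Y) → (X ⟶ Y)
  map_id : ∀ X : D, map (𝟙 X) = 𝟙 X
  map_comp : ∀ {X Y Z : D} (s : X ⟶ Y) (t : Y ⟶ Z), map (s ≫ t) = map s ≫ map t
  map_tensor : ∀ {X Y Z T : D} (s : X ⟶ Y) (t : Z ⟶ T), map (s ⊗ₘ t) = map s ⊗ₘ map t
  map_associator : ∀ X Y Z : D, map (α_ X Y Z).hom = (α_ X Y Z).hom
  map_leftUnitor : ∀ X : D, map (λ_ X).hom = (λ_ X).hom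
  map_rightUnitor : ∀ X : D, map (ρ_ X).hom = (ρ_ X).hom

namespace Twist

variable {D : Type u} [Category.{v} D] [MonoidalCategory D] (T : Twist D)

/-- The functor which a twist induces on the completion with respect to splitting idempotents. -/
def karoubi : Karoubi D ⥤ Karoubi D where
  obj P := ⟨P.X, T.map P.p, by rw [← T.map_comp, P.idem]⟩
  map {P Q} s := ⟨T.map s.f, by
    change T.map P.p ≫ T.map s.f ≫ T.map Q.p = _
    rw [← T.map_comp, ← T.map_comp, s.comm]⟩
  map_id P := rfl
  map_comp s t := Karoubi.hom_ext _ _ (T.map_comp s.f t.f)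

lemma karoubi_eq_id (h : ∀ {X Y : D} (s : X ⟶ Y), T.map s = s) : T.karoubi = 𝟭 _ := by
  have e : ∀ P, T.karoubi.obj P = P := fun P => karoubi_mk_eq _ P.idem (h _)
  refine CategoryTheory.Functor.ext e fun P Q s => Karoubi.hom_ext _ _ ?_
  have h1 : Karoubi.Hom.f (eqToHom (e P)) = T.map P.p := karoubi_eqToHom_f _ _ _
  have h2 : Karoubi.Hom.f (eqToHom (e Q).symm) = Q.p := karoubi_eqToHom_f _ _ _
  refine (h s.f).trans (Eq.trans ?_ (congrArg₂ (fun a b => a ≫ s.f ≫ b) h1 h2).symm)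
  change s.f = T.map P.p ≫ s.f ≫ Q.p
  rw [h]
  simp

lemma karoubi_eq_comp (T' T'' : Twist D)
    (h : ∀ {X Y : D} (s : X ⟶ Y), T.map s = T'.map (T''.map s)) :
    T.karoubi = T''.karoubi ⋙ T'.karoubi := by
  have e : ∀ P, T.karoubi.obj P = (T''.karoubi ⋙ T'.karoubi).obj P :=
    fun P => karoubi_mk_eq _ _ (h _)
  refine CategoryTheory.Functor.ext e fun P Q s => Karoubi.hom_ext _ _ ?_
  have h1 : Karoubi.Hom.f (eqToHom (e P)) = T.map P.p := karoubi_eqToHom_f _ _ _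
  have h2 : Karoubi.Hom.f (eqToHom (e Q).symm) = T'.map (T''.map Q.p) := karoubi_eqToHom_f _ _ _
  refine (h s.f).trans (Eq.trans ?_
    (congrArg₂ (fun a b => a ≫ T'.map (T''.map s.f) ≫ b) h1 h2).symm)
  change T'.map (T''.map s.f) = T.map P.p ≫ T'.map (T''.map s.f) ≫ T'.map (T''.map Q.p)
  rw [← h, ← h, ← T.map_comp, ← T.map_comp]
  simp

lemma karoubi_obj_tensor (P Q : Karoubi D) :
    T.karoubi.obj P ⊗ T.karoubi.obj Q = T.karoubi.obj (P ⊗ Q) :=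
  karoubi_mk_eq _ _ (T.map_tensor _ _).symm

lemma karoubi_obj_unit : 𝟙_ (Karoubi D) = T.karoubi.obj (𝟙_ (Karoubi D)) :=
  karoubi_mk_eq _ _ (T.map_id _).symm

/-- The structure morphisms are transports, hence idempotents underneath; once these are absorbed,
the axioms say that `T` preserves the constraints of `D`. -/
lemma isStrictTensorFunctor_karoubi : IsStrictTensorFunctor T.karoubi := by
  have hμ : ∀ P Q : Karoubi D, Karoubi.Hom.f (eqToHom (T.karoubi_obj_tensor P Q)) =
      T.map P.p ⊗ₘ T.map Q.p := fun P Q => karoubi_eqToHom_f _ _ _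
  have hε : Karoubi.Hom.f (eqToHom T.karoubi_obj_unit) = 𝟙 (𝟙_ D) := karoubi_eqToHom_f _ _ _
  let core : T.karoubi.CoreMonoidal :=
    { εIso := eqToIso T.karoubi_obj_unit
      μIso := fun P Q => eqToIso (T.karoubi_obj_tensor P Q)
      μIso_hom_natural_left := fun {P Q} s R => Karoubi.hom_ext _ _ <| by
        refine (congrArg (fun a => (T.map s.f ⊗ₘ T.map R.p) ≫ a) (hμ Q R)).trans
          (Eq.trans ?_ (congrArg (fun a => a ≫ T.map (s.f ⊗ₘ R.p)) (hμ P R)).symm)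
        change (T.map s.f ⊗ₘ T.map R.p) ≫ (T.map Q.p ⊗ₘ T.map R.p) =
          (T.map P.p ⊗ₘ T.map R.p) ≫ T.map (s.f ⊗ₘ R.p)
        simp only [← T.map_tensor, ← T.map_comp]
        simp
      μIso_hom_natural_right := fun {P Q} R s => Karoubi.hom_ext _ _ <| by
        refine (congrArg (fun a => (T.map R.p ⊗ₘ T.map s.f) ≫ a) (hμ R Q)).trans
          (Eq.trans ?_ (congrArg (fun a => a ≫ T.map (R.p ⊗ₘ s.f)) (hμ R P)).symm)
        change (T.map R.p ⊗ₘ T.map s.f) ≫ (T.map R.p ⊗ₘ T.map Q.p) =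
          (T.map R.p ⊗ₘ T.map P.p) ≫ T.map (R.p ⊗ₘ s.f)
        simp only [← T.map_tensor, ← T.map_comp]
        simp
      associativity := fun P Q R => Karoubi.hom_ext _ _ <| by
        refine (congrArg₂ (fun a b => (a ⊗ₘ T.map R.p) ≫ b ≫
          T.map (((P.p ⊗ₘ Q.p) ⊗ₘ R.p) ≫ (α_ P.X Q.X R.X).hom)) (hμ P Q)
          (hμ (P ⊗ Q) R)).trans (Eq.trans ?_ (congrArg₂ (fun a b =>
          (((T.map P.p ⊗ₘ T.map Q.p) ⊗ₘ T.map R.p) ≫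
            (α_ P.X Q.X R.X).hom) ≫ (T.map P.p ⊗ₘ a) ≫ b) (hμ Q R)
          (hμ P (Q ⊗ R))).symm)
        change ((T.map P.p ⊗ₘ T.map Q.p) ⊗ₘ T.map R.p) ≫ (T.map (P.p ⊗ₘ Q.p) ⊗ₘ T.map R.p) ≫
          T.map (((P.p ⊗ₘ Q.p) ⊗ₘ R.p) ≫ (α_ P.X Q.X R.X).hom) =
          (((T.map P.p ⊗ₘ T.map Q.p) ⊗ₘ T.map R.p) ≫ (α_ P.X Q.X R.X).hom) ≫
            (T.map P.p ⊗ₘ (T.map Q.p ⊗ₘ T.map R.p)) ≫ (T.map P.p ⊗ₘ T.map (Q.p ⊗ₘ R.p))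
        have hid : ∀ P : Karoubi D, T.map P.p ≫ T.map P.p = T.map P.p := fun P => by
          rw [← T.map_comp, P.idem]
        rw [T.map_comp, T.map_associator]
        simp only [T.map_tensor, Category.assoc, tensorHom_comp_tensorHom, hid,
          associator_naturality, associator_naturality_assoc]
      left_unitality := fun P => Karoubi.hom_ext _ _ <| by
        refine Eq.trans ?_ (congrArg₂ (fun a b => (a ⊗ₘ T.map P.p) ≫ b ≫
          T.map ((𝟙 _ ⊗ₘ P.p) ≫ (λ_ P.X).hom)) hε (hμ (𝟙_ _) P)).symm
        change (𝟙 _ ⊗ₘ T.map P.p) ≫ (λ_ P.X).hom = (𝟙 _ ⊗ₘ T.map P.p) ≫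
          (T.map (𝟙 _) ⊗ₘ T.map P.p) ≫ T.map ((𝟙 _ ⊗ₘ P.p) ≫ (λ_ P.X).hom)
        rw [T.map_comp, T.map_leftUnitor, T.map_tensor, T.map_id]
        simp [← T.map_comp]
      right_unitality := fun P => Karoubi.hom_ext _ _ <| by
        refine Eq.trans ?_ (congrArg₂ (fun a b => (T.map P.p ⊗ₘ a) ≫ b ≫
          T.map ((P.p ⊗ₘ 𝟙 _) ≫ (ρ_ P.X).hom)) hε (hμ P (𝟙_ _))).symm
        change (T.map P.p ⊗ₘ 𝟙 _) ≫ (ρ_ P.X).hom = (T.map P.p ⊗ₘ 𝟙 _) ≫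
          (T.map P.p ⊗ₘ T.map (𝟙 _)) ≫ T.map ((P.p ⊗ₘ 𝟙 _) ≫ (ρ_ P.X).hom)
        rw [T.map_comp, T.map_rightUnitor, T.map_tensor, T.map_id]
        simp [← T.map_comp] }
  exact ⟨core.toMonoidal, fun P Q => ⟨T.karoubi_obj_tensor P Q, rfl⟩, T.karoubi_obj_unit, rfl⟩

end Twist

end Twist

/-! ### The action of `Aut(Γ)` -/

section Action

variable {F : Type w} [Field F] {C : Type u} [Category.{v} C] [Preadditive C]
  [Linear F C] [MonoidalCategory C] [MonoidalPreadditive C] [MonoidalLinear F C]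
  [BraidedCategory C] {Γ : C} [MonObj Γ] [ComonObj Γ] [IsCommComonObj Γ]

open PreGalois

lemma galoisMap_hom (g : GaloisGroup Γ) {X Y : PreGalois Γ} (s : X ⟶ Y) :
    (galoisMap Γ g s).hom = (g⁻¹).toHom ▷ X.of ≫ s.hom := rfl

lemma galoisMap_one {X Y : PreGalois Γ} (s : X ⟶ Y) : galoisMap Γ 1 s = s := by
  ext
  rw [galoisMap_hom, inv_one, GaloisGroup.toHom_one, id_whiskerRight, Category.id_comp]

lemma galoisMap_mul (g h : GaloisGroup Γ) {X Y : PreGalois Γ} (s : X ⟶ Y) :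
    galoisMap Γ (g * h) s = galoisMap Γ g (galoisMap Γ h s) := by
  ext
  simp only [galoisMap_hom, mul_inv_rev, GaloisGroup.toHom_mul, comp_whiskerRight, Category.assoc]

lemma galoisMap_ne_zero (g : GaloisGroup Γ) {X Y : PreGalois Γ} {s : X ⟶ Y} (hs : s ≠ 0) :
    galoisMap Γ g s ≠ 0 := by
  intro h
  apply hs
  rw [← galoisMap_one s, ← inv_mul_cancel g, galoisMap_mul, h]
  ext
  rw [galoisMap_hom, zero_hom, comp_zero]

lemma galoisMap_point (g : GaloisGroup Γ) (f : Γ ⟶ Γ) :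
    galoisMap Γ g (point f) = point ((g⁻¹).toHom ≫ f) := by
  ext
  change (g⁻¹).toHom ▷ (𝟙_ C) ≫ (ρ_ Γ).hom ≫ f = (ρ_ Γ).hom ≫ (g⁻¹).toHom ≫ f
  simp

variable [Fintype (GaloisGroup Γ)]

lemma galoisMap_inc (H : IsGaloisObject F Γ) (g : GaloisGroup Γ) {X Y : C} (f : X ⟶ Y) :
    galoisMap Γ g (inc f) = inc f := by
  ext
  rw [galoisMap_hom, inc_hom, ← comp_whiskerRight_assoc, H.aut_counit]

lemma galoisMap_id (H : IsGaloisObject F Γ) (g : GaloisGroup Γ) (X : PreGalois Γ) :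
    galoisMap Γ g (𝟙 X) = 𝟙 X := by
  rw [← inc_id, galoisMap_inc H]

/-- Composition copies the `Γ`-leg by `Δ`, and automorphisms respect `Δ`. The same reason underlies
`galoisMap_tensor`. -/
lemma galoisMap_comp (H : IsGaloisObject F Γ) (g : GaloisGroup Γ) {X Y Z : PreGalois Γ}
    (s : X ⟶ Y) (t : Y ⟶ Z) : galoisMap Γ g (s ≫ t) = galoisMap Γ g s ≫ galoisMap Γ g t := by
  ext
  simp only [galoisMap_hom, comp_hom]
  rw [← comp_whiskerRight_assoc, H.aut_comul, whiskerLeft_comp_assoc,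
    MonoidalCategory.tensorHom_def', whisker_exchange_assoc]
  monoidal

lemma galoisMap_tensor (H : IsGaloisObject F Γ) (g : GaloisGroup Γ) {X Y Z T : PreGalois Γ}
    (s : X ⟶ Y) (t : Z ⟶ T) :
    galoisMap Γ g (s ⊗ₘ t) = galoisMap Γ g s ⊗ₘ galoisMap Γ g t := by
  ext
  change _ ▷ (X.of ⊗ Z.of) ≫ Δ[Γ] ▷ (X.of ⊗ Z.of) ≫ tensorμ Γ Γ X.of Z.of ≫ (s.hom ⊗ₘ t.hom) =
    Δ[Γ] ▷ (X.of ⊗ Z.of) ≫ tensorμ Γ Γ X.of Z.of ≫ ((_ ▷ _ ≫ s.hom) ⊗ₘ (_ ▷ _ ≫ t.hom))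
  rw [← comp_whiskerRight_assoc, H.aut_comul, ← tensorHom_comp_tensorHom, comp_whiskerRight_assoc,
    ← tensorHom_id, ← tensorHom_id, ← tensorHom_id, ← tensorHom_id, ← id_tensorHom_id,
    tensorμ_natural_assoc]

/-- The action of `Aut(Γ)` on the morphisms of `C ⋊₀ S`. -/
def galoisTwist (H : IsGaloisObject F Γ) (g : GaloisGroup Γ) : Twist (PreGalois Γ) where
  map s := galoisMap Γ g s
  map_id X := galoisMap_id H g X
  map_comp s t := galoisMap_comp H g s t
  map_tensor s t := galoisMap_tensor H g s t
  map_associator _ _ _ := galoisMap_inc H g _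
  map_leftUnitor _ := galoisMap_inc H g _
  map_rightUnitor _ := galoisMap_inc H g _

lemma isGaloisAction_galoisTwist (H : IsGaloisObject F Γ) :
    IsGaloisAction Γ (fun g => (galoisTwist H g).karoubi) :=
  fun _ => ⟨fun _ => ⟨_, rfl⟩, fun _ _ _ => HEq.rfl⟩

/-- Applying `γ_g` to the grading equation fixes the monodromy, since it comes from `C`, and
precomposes both points with `g⁻¹`. Postcomposing with `g` restores the identity point on one side
and leaves `g ∘ h ∘ g⁻¹` on the other. -/
lemma PreGalois.IsGraded.galoisMap (H : IsGaloisObject F Γ) (g h : GaloisGroup Γ) {X Y : PreGalois Γ}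
    {p : X ⟶ Y} (hp : IsGraded h.toHom p) :
    IsGraded (g * h * g⁻¹).toHom (galoisMap Γ g p) := by
  have h1 := congrArg (_root_.galoisMap Γ g) hp
  have h2 : _root_.galoisMap Γ g (monodromy Γ Y) = monodromy Γ Y := galoisMap_inc H g _
  rw [galoisMap_comp H, galoisMap_tensor H, galoisMap_tensor H, h2, galoisMap_point,
    galoisMap_point, Category.comp_id] at h1
  have h3 := congrArg (· ≫ inc g.toHom ▷ Y) h1
  simp only [Category.assoc] at h3
  rw [← inc_whiskerRight_comp_monodromy, ← tensorHom_id, tensorHom_comp_tensorHom_assoc,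
    tensorHom_comp_tensorHom, point_comp_inc, point_comp_inc, Category.comp_id,
    GaloisGroup.toHom_inv_comp] at h3
  exact h3.trans (by rw [mul_assoc, GaloisGroup.toHom_mul, GaloisGroup.toHom_mul])

end Action
end

noncomputable section

open scoped ComonObj MonObj TensorProduct

/-! ### Tensor products of non-zero morphisms -/

section TensorNonzero

/-- In a regular tensor category whose unit has no non-trivial idempotents, the tensor product of
non-zero morphisms is non-zero. -/
lemma IsRegularCat.eq_zero_or_eq_zero_of_tensor {D : Type u} [Category.{v} D] [MonoidalCategory D]
    [Preadditive D] [MonoidalPreadditive D] (h : IsRegularCat D)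
    (unit : ∀ e : 𝟙_ D ⟶ 𝟙_ D, e ≫ e = e → e = 0 ∨ e = 𝟙 _)
    (A : D) {X X' Y Y' : D} [ExactPairing A X] {p : X ⟶ X'} {q : Y ⟶ Y'}
    (hpq : p ⊗ₘ q = 0) : p = 0 ∨ q = 0 := by
  -- A generalized inverse of the name of `p` gives an idempotent of the unit. If it is zero, the
  -- name and hence `p` vanish; if it is the identity, the name is split mono and `q` can be
  -- recovered from `p ⊗ q`.
  obtain ⟨r, hr⟩ := h (η_ A X ≫ A ◁ p)
  rcases unit ((η_ A X ≫ A ◁ p) ≫ r) (by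
      simpa only [Category.assoc] using hr =≫ r) with he | he
  · left
    have h0 : η_ A X ≫ A ◁ p = 0 := by rw [← hr, ← Category.assoc, he, zero_comp]
    have h1 : X ◁ (η_ A X ≫ A ◁ p) ≫ (α_ _ _ _).inv ≫ ε_ A X ▷ X' =
        (ρ_ X).hom ≫ p ≫ (λ_ X').inv := by
      have := ExactPairing.coevaluation_evaluation A X
      rw [whiskerLeft_comp_assoc, associator_inv_naturality_right_assoc, whisker_exchange,
        reassoc_of% this, leftUnitor_inv_naturality]
    rw [h0] at h1
    simp only [MonoidalPreadditive.whiskerLeft_zero, zero_comp] at h1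
    have h2 := congrArg (fun t => (ρ_ X).inv ≫ t ≫ (λ_ X').hom) h1
    simpa using h2.symm
  · right
    have h1 : (η_ A X ≫ A ◁ p) ▷ Y ≫ (A ⊗ X') ◁ q = 0 := by
      have : (η_ A X ≫ A ◁ p) ▷ Y ≫ (A ⊗ X') ◁ q =
          η_ A X ▷ Y ≫ (α_ _ _ _).hom ≫ A ◁ (p ⊗ₘ q) ≫ (α_ _ _ _).inv := by
        rw [MonoidalCategory.tensorHom_def]
        monoidal
      rw [this, hpq]
      simp
    have h2 : (((η_ A X ≫ A ◁ p) ≫ r) ▷ Y) ≫ _ ◁ q = 0 := by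
      rw [comp_whiskerRight, Category.assoc, ← whisker_exchange, reassoc_of% h1, zero_comp]
    rw [he, id_whiskerRight, Category.id_comp] at h2
    have h3 := leftUnitor_naturality q
    rw [h2, zero_comp, eq_comm] at h3
    rwa [← cancel_epi (λ_ Y).hom, comp_zero]

end TensorNonzero

/-! ### Free comodules and Maschke averaging -/

namespace PreGalois

section

variable {C : Type u} [Category.{v} C] [MonoidalCategory C] {Γ : C} [ComonObj Γ]

/-- The morphism of free comodules which belongs to a morphism of `C ⋊₀ S`. -/
def hat {X Y : PreGalois Γ} (s : X ⟶ Y) : Γ ⊗ X.of ⟶ Γ ⊗ Y.of :=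
  Δ[Γ] ▷ X.of ≫ (α_ Γ Γ X.of).hom ≫ Γ ◁ s.hom

lemma comp_hom_eq {X Y Z : PreGalois Γ} (s : X ⟶ Y) (t : Y ⟶ Z) :
    (s ≫ t).hom = hat s ≫ t.hom := by
  simp [hat, comp_hom]

lemma hat_comul {X Y : PreGalois Γ} (s : X ⟶ Y) :
    hat s ≫ Δ[Γ] ▷ Y.of ≫ (α_ _ _ _).hom = Δ[Γ] ▷ X.of ≫ (α_ _ _ _).hom ≫ Γ ◁ hat s := by
  have h := comul_assoc_aux (Γ := Γ) X.of
  simp only [hat, whiskerLeft_comp, Category.assoc]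
  rw [reassoc_of% h, whisker_exchange_assoc, associator_naturality_right]

lemma hat_comp {X Y Z : PreGalois Γ} (s : X ⟶ Y) (t : Y ⟶ Z) :
    hat (s ≫ t) = hat s ≫ hat t := by
  have h := hat_comul s
  rw [hat, comp_hom_eq, whiskerLeft_comp, hat.eq_def t, reassoc_of% h]

/-- The counit recovers `s` from `hat s`, so equations in `C ⋊₀ S` may be checked on comodule
morphisms in `C`. -/
lemma hat_injective {X Y : PreGalois Γ} {s t : X ⟶ Y} (h : hat s = hat t) : s = t := by
  have key : ∀ s : X ⟶ Y, hat s ≫ ε[Γ] ▷ Y.of ≫ (λ_ Y.of).hom = s.hom := by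
    intro s
    have := congrArg Hom.hom (Category.comp_id s)
    rwa [comp_hom_eq, id_hom] at this
  ext
  rw [← key, ← key t, h]

/-- The pairing `(A, X)` of `C` seen in `C ⋊₀ S`. -/
@[reducible]
def incExactPairing [BraidedCategory C] [IsCommComonObj Γ] (A X : C) [ExactPairing A X] :
    ExactPairing (⟨A⟩ : PreGalois Γ) ⟨X⟩ where
  coevaluation' := inc (η_ A X)
  evaluation' := inc (ε_ A X)
  coevaluation_evaluation' := by
    change wL _ (inc _) ≫ inc _ ≫ wR (inc _) _ = inc _ ≫ inc _
    simp only [wL_inc, wR_inc, ← inc_comp]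
    congr 1
    exact ExactPairing.coevaluation_evaluation A X
  evaluation_coevaluation' := by
    change wR (inc _) _ ≫ inc _ ≫ wL _ (inc _) = inc _ ≫ inc _
    simp only [wL_inc, wR_inc, ← inc_comp]
    congr 1
    exact ExactPairing.evaluation_coevaluation A X

end

variable {F : Type w} [Field F] [CharZero F] {C : Type u} [Category.{v} C] [Preadditive C]
  [Linear F C] [MonoidalCategory C] [MonoidalPreadditive C] [MonoidalLinear F C]
  [BraidedCategory C] {Γ : C} [MonObj Γ] [ComonObj Γ] [IsCommComonObj Γ]
  [Fintype (GaloisGroup Γ)]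

/-- The category `C ⋊₀ S` is regular if `C` is: a generalized inverse in `C` is averaged by means
of the Frobenius structure of `Γ`. -/
lemma isRegularCat (H : IsGaloisObject F Γ) (hC : IsRegularCat C) :
    IsRegularCat (PreGalois Γ) := by
  intro X Y s
  have hn : (Fintype.card (GaloisGroup Γ) : F) ≠ 0 := by simp
  obtain ⟨r, hr⟩ := hC (hat s)
  let t : Y ⟶ X := ⟨(Fintype.card (GaloisGroup Γ) : F)⁻¹ • (Δ[Γ] ▷ Y.of ≫ (α_ _ _ _).hom ≫ Γ ◁ r ≫
    (α_ _ _ _).inv ≫ (μ[Γ] ≫ ε[Γ]) ▷ X.of ≫ (λ_ X.of).hom)⟩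
  -- The comodule morphism of `t` is the average of `r`: comultiply, apply `r` to the inner leg,
  -- multiply, and divide by the group order.
  have h1 : hat t = (Fintype.card (GaloisGroup Γ) : F)⁻¹ • (Δ[Γ] ▷ Y.of ≫ (α_ _ _ _).hom ≫
      Γ ◁ r ≫ (α_ _ _ _).inv ≫ μ[Γ] ▷ X.of) := by
    have e1 := comul_assoc_aux (Γ := Γ) Y.of
    have e2 : Δ[Γ] ▷ (Γ ⊗ X.of) ≫ (α_ Γ Γ (Γ ⊗ X.of)).hom ≫ Γ ◁ (α_ Γ Γ X.of).inv ≫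
        Γ ◁ (μ[Γ] ≫ ε[Γ]) ▷ X.of ≫ Γ ◁ (λ_ X.of).hom = (α_ _ _ _).inv ≫ μ[Γ] ▷ X.of := by
      have e3 := congrArg (fun a => a ▷ X.of) H.comul_mul_counit
      rw [← e3]
      monoidal
    simp only [t, hat, MonoidalLinear.whiskerLeft_smul, Linear.comp_smul, whiskerLeft_comp]
    congr 1
    rw [reassoc_of% e1, ← associator_naturality_right_assoc, ← whisker_exchange_assoc, e2]
  -- By the Frobenius relation a comodule morphism `hat s` is also a module morphism.
  have h2 : (α_ _ _ _).inv ≫ μ[Γ] ▷ X.of ≫ hat s = Γ ◁ hat s ≫ (α_ _ _ _).inv ≫ μ[Γ] ▷ Y.of := by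
    have e3 := congrArg (fun a => a ▷ X.of) H.mul_comul
    simp only [comp_whiskerRight] at e3
    rw [hat, reassoc_of% e3]
    simp only [whiskerLeft_comp, Category.assoc]
    rw [associator_inv_naturality_right_assoc, whisker_exchange]
    monoidal
  refine ⟨t, hat_injective ?_⟩
  rw [hat_comp, hat_comp, h1]
  simp only [Linear.comp_smul, Linear.smul_comp, Category.assoc]
  -- Both outer copies of `hat s` are moved inside the average, where `hr` applies; what remains is
  -- `μ ∘ Δ`, which cancels the normalization.
  have h3 := hat_comul s
  rw [reassoc_of% h3, h2, ← whiskerLeft_comp_assoc, ← whiskerLeft_comp_assoc,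
    Category.assoc, hr, ← h2,
    Iso.hom_inv_id_assoc, ← comp_whiskerRight_assoc, H.comul_mul, MonoidalLinear.smul_whiskerRight,
    Linear.smul_comp, smul_smul, inv_mul_cancel₀ hn]
  simp

/-- Endomorphisms of the unit are maps `Γ ⟶ 1` of `C`, that is, multiples of `ε`, which is the
identity of the unit. -/
lemma unit_idem (H : IsGaloisObject F Γ) (e : 𝟙_ (PreGalois Γ) ⟶ 𝟙_ (PreGalois Γ))
    (he : e ≫ e = e) : e = 0 ∨ e = 𝟙 _ := by
  obtain ⟨c, hc⟩ := H.exists_smul_counit ((ρ_ Γ).inv ≫ e.hom)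
  have h1 : e = c • 𝟙 _ := by
    ext
    rw [Iso.inv_comp_eq] at hc
    rw [hc, smul_hom, id_hom]
    change (ρ_ Γ).hom ≫ (c • ε[Γ]) = c • (ε[Γ] ▷ (𝟙_ C) ≫ (λ_ (𝟙_ C)).hom)
    rw [Linear.comp_smul]
    congr 1
    monoidal
  by_cases h0 : c = 0
  · left
    rw [h1, h0, zero_smul]
  · right
    rw [h1, Linear.smul_comp, Category.id_comp] at he
    rw [h1]
    exact smul_right_injective _ h0 he

lemma id_unit_ne_zero (H : IsGaloisObject F Γ) : 𝟙 (𝟙_ (PreGalois Γ)) ≠ 0 := by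
  intro h
  apply H.counit_ne_zero
  have h1 := congrArg Hom.hom h
  rw [id_hom, zero_hom] at h1
  change ε[Γ] ▷ (𝟙_ C) ≫ (λ_ (𝟙_ C)).hom = 0 at h1
  have h2 : ε[Γ] = (ρ_ Γ).inv ≫ ε[Γ] ▷ (𝟙_ C) ≫ (λ_ (𝟙_ C)).hom := by monoidal
  rw [h2, h1, comp_zero]

lemma finiteDimensional_hom (hfd : ∀ X Y : C, FiniteDimensional F (X ⟶ Y)) (X Y : PreGalois Γ) :
    FiniteDimensional F (X ⟶ Y) := by
  have := hfd (Γ ⊗ X.of) Y.of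
  let l : (X ⟶ Y) →ₗ[F] (Γ ⊗ X.of ⟶ Y.of) := ⟨⟨Hom.hom, add_hom⟩, smul_hom⟩
  exact FiniteDimensional.of_injective l fun _ _ h => Hom.ext h

end PreGalois

/-! ### Assembly of the crossed category -/

section Crossed

open PreGalois

variable {F : Type w} [Field F] [CharZero F] {C : Type u} [Category.{v} C] [Preadditive C]
  [Linear F C] [MonoidalCategory C] [MonoidalPreadditive C] [MonoidalLinear F C]
  [BraidedCategory C] {Γ : C} [MonObj Γ] [ComonObj Γ] [IsCommComonObj Γ]
  [Fintype (GaloisGroup Γ)]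

/-- The components restrict to idempotents of `P` with sum `1`, so one is non-zero; by simplicity
that one is the identity. -/
lemma exists_isGraded_of_simple (H : IsGaloisObject F Γ) (P : GaloisCat Γ) [Simple P] :
    ∃ g : GaloisGroup Γ, IsGraded g.toHom P.p := by
  classical
  have h1 : ∃ g : GaloisGroup Γ, P.p ≫ component F g P.X ≠ 0 := by
    by_contra! h
    apply id_nonzero P
    ext1
    have h2 : P.p = ∑ g : GaloisGroup Γ, P.p ≫ component F g P.X := by
      rw [← Preadditive.comp_sum, sum_component H, Category.comp_id]
    change P.p = 0
    rw [h2]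
    exact Finset.sum_eq_zero fun g _ => h g
  obtain ⟨g, hg⟩ := h1
  have hidem : component F g P.X ≫ component F g P.X = component F g P.X := by
    rw [component_comp_component H, if_pos rfl]
  let e : P ⟶ P := ⟨P.p ≫ component F g P.X, by
    rw [Category.assoc, ← component_naturality H, P.idem_assoc, P.idem_assoc]⟩
  have he : e ≫ e = e := by
    ext1
    change (P.p ≫ component F g P.X) ≫ (P.p ≫ component F g P.X) = P.p ≫ component F g P.X
    rw [Category.assoc, ← Category.assoc (component F g P.X), ← component_naturality H,
      Category.assoc, hidem, P.idem_assoc]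
  have h2 := Simple.eq_id_of_idem he fun h => hg (congrArg Karoubi.Hom.f h)
  exact ⟨g, isGraded_of_comp_component H (congrArg Karoubi.Hom.f h2)⟩

/-- The idempotent of a direct sum is a sum of maps through the idempotents of its summands, and
each of these factors through the total one, so a grade passes both ways. Non-emptiness of the sum
corresponds to `P.p ≠ 0`. -/
lemma isHomogeneousOfGrade_iff (H : IsGaloisObject F Γ) (hss : IsSemisimpleCat (GaloisCat Γ))
    (P : GaloisCat Γ) (g : GaloisGroup Γ) :
    IsHomogeneousOfGrade Γ P g ↔ IsGraded g.toHom P.p ∧ P.p ≠ 0 := by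
  classical
  constructor
  · rintro ⟨n, Y, hn, hY, hs⟩
    obtain ⟨i, p, h1, h2, h3⟩ := hs.exists_maps
    constructor
    · have h4 : P.p = ∑ j, (p j).f ≫ (Y j).p ≫ (i j).f := by
        have := congrArg Karoubi.Hom.f h3
        rw [Karoubi.sum_hom] at this
        simpa using this.symm
      rw [h4]
      exact IsGraded.sum fun j _ =>
        (((isDegree_iff H _ _).1 (hY j).2).comp_right H.symm _).comp_left _
    · intro h
      have := (hY ⟨0, hn⟩).1
      apply id_nonzero (Y ⟨0, hn⟩)
      rw [← h1 ⟨0, hn⟩]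
      ext1
      change (i ⟨0, hn⟩).f ≫ (p ⟨0, hn⟩).f = 0
      rw [← Karoubi.comp_p (i ⟨0, hn⟩), h, comp_zero, zero_comp]
  · rintro ⟨hP, h0⟩
    obtain ⟨n, Y, hY, hs⟩ := hss P
    refine ⟨n, Y, ?_, fun j => ⟨hY j, (isDegree_iff H _ _).2 ?_⟩, hs⟩
    · rcases Nat.eq_zero_or_pos n with rfl | hn
      · obtain ⟨i, p, h1, h2, h3⟩ := hs.exists_maps
        exact (h0 (by simpa using (congrArg Karoubi.Hom.f h3).symm)).elim
      · exact hn
    · obtain ⟨i, p, h1, h2, h3⟩ := hs.exists_maps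
      have h4 : (Y j).p = (i j).f ≫ P.p ≫ (p j).f := by
        have := congrArg Karoubi.Hom.f (h1 j)
        simpa using this.symm
      rw [h4]
      exact (hP.comp_right H.symm _).comp_left _

/-- The crossed category belonging to a Galois object. -/
def galoisCrossedCategory (H : IsGaloisObject F Γ) (hreg : IsRegularCat (PreGalois Γ))
    (hss : IsSemisimpleCat (GaloisCat Γ)) [LeftRigidCategory C] :
    CrossedCategory (GaloisGroup Γ) (GaloisCat Γ) where
  homogeneous P := ∃ g, IsHomogeneousOfGrade Γ P g
  isMonoidal :=
    { prop_unit := ⟨1, (isHomogeneousOfGrade_iff H hss _ _).2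
        ⟨isGraded_unit _, id_unit_ne_zero H⟩⟩
      prop_tensor := by
        rintro P Q ⟨g, hg⟩ ⟨h, hh⟩
        rw [isHomogeneousOfGrade_iff H hss] at hg hh
        refine ⟨g * h, (isHomogeneousOfGrade_iff H hss _ _).2 ⟨hg.1.tensor hh.1, fun h0 => ?_⟩⟩
        -- A dual in `C` remains a dual in `C ⋊₀ S`, which makes the tensor product of the two
        -- idempotents non-zero.
        have := incExactPairing (Γ := Γ) (ᘁP.X.of) P.X.of
        exact (hreg.eq_zero_or_eq_zero_of_tensor (unit_idem H) ⟨ᘁP.X.of⟩ h0).elim hg.2 hh.2 }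
  grade P hP := hP.choose
  grade_iso P Q hP hQ := by
    rintro ⟨e⟩
    classical
    have h1 := (isHomogeneousOfGrade_iff H hss _ _).1 hP.choose_spec
    have h2 := (isHomogeneousOfGrade_iff H hss _ _).1 hQ.choose_spec
    have h3 : Q.p = e.inv.f ≫ P.p ≫ e.hom.f := by
      rw [Karoubi.p_comp]
      exact (congrArg Karoubi.Hom.f e.inv_hom_id).symm
    refine eq_of_isGraded H h2.2 ?_ h2.1
    rw [h3]
    exact (h1.1.comp_right H.symm _).comp_left _
  action g := (galoisTwist H g).karoubi
  action_one := Twist.karoubi_eq_id _ fun s => galoisMap_one s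
  action_mul g h := Twist.karoubi_eq_comp _ _ _ fun s => galoisMap_mul g h s
  action_strict g := Twist.isStrictTensorFunctor_karoubi _
  grade_tensor P Q hP hQ hPQ := by
    classical
    have h1 := (isHomogeneousOfGrade_iff H hss _ _).1 hP.choose_spec
    have h2 := (isHomogeneousOfGrade_iff H hss _ _).1 hQ.choose_spec
    have h3 := (isHomogeneousOfGrade_iff H hss _ _).1 hPQ.choose_spec
    exact eq_of_isGraded H h3.2 h3.1 (h1.1.tensor h2.1)
  grade_action g P hP := by
    classical
    have h1 := (isHomogeneousOfGrade_iff H hss _ _).1 hP.choose_spec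
    have h2 : IsGraded (g * hP.choose * g⁻¹).toHom (galoisMap Γ g P.p) ∧ galoisMap Γ g P.p ≠ 0 :=
      ⟨h1.1.galoisMap H g _, galoisMap_ne_zero g h1.2⟩
    have h3 : ∃ h, IsHomogeneousOfGrade Γ ((galoisTwist H g).karoubi.obj P) h :=
      ⟨_, (isHomogeneousOfGrade_iff H hss _ _).2 h2⟩
    exact ⟨h3, eq_of_isGraded H h2.2 ((isHomogeneousOfGrade_iff H hss _ _).1 h3.choose_spec).1 h2.1⟩
  exists_directSum P := by
    obtain ⟨n, Y, hY, hs⟩ := hss P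
    refine ⟨n, Y, fun j => ?_, hs⟩
    have := hY j
    obtain ⟨g, hg⟩ := exists_isGraded_of_simple H (Y j)
    exact ⟨g, (isHomogeneousOfGrade_iff H hss _ _).2
      ⟨hg, fun h => id_nonzero (Y j) (Karoubi.hom_ext _ _ h)⟩⟩

lemma galoisCrossedCategory_grade_eq_iff (H : IsGaloisObject F Γ)
    (hreg : IsRegularCat (PreGalois Γ)) (hss : IsSemisimpleCat (GaloisCat Γ))
    [LeftRigidCategory C] (P : GaloisCat Γ)
    (hP : (galoisCrossedCategory H hreg hss).homogeneous P) (g : GaloisGroup Γ) :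
    (galoisCrossedCategory H hreg hss).grade P hP = g ↔ IsHomogeneousOfGrade Γ P g := by
  classical
  have h1 : IsHomogeneousOfGrade Γ P ((galoisCrossedCategory H hreg hss).grade P hP) :=
    Exists.choose_spec hP
  constructor
  · rintro rfl
    exact h1
  · intro h
    rw [isHomogeneousOfGrade_iff H hss] at h h1
    exact eq_of_isGraded H h.2 h1.1 h.1

end Crossed
end

noncomputable section

open scoped ComonObj MonObj TensorProduct

/-! ### The regular algebra in `Rep G`, computed on the basis `δ_g` -/

namespace RegularAlgebra

variable {F G : Type w} [Field F] [Group G]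

/-- The linear map underlying an intertwiner. -/
abbrev lin {V W : FDRep F G} (f : V ⟶ W) : V →ₗ[F] W := f.hom.hom.hom

lemma lin_comp {V W U : FDRep F G} (f : V ⟶ W) (g : W ⟶ U) (x : V) :
    lin (f ≫ g) x = lin g (lin f x) := rfl

lemma lin_id (V : FDRep F G) (x : V) : lin (𝟙 V) x = x := rfl

lemma lin_add {V W : FDRep F G} (f g : V ⟶ W) (x : V) : lin (f + g) x = lin f x + lin g x := rfl

lemma lin_zero {V W : FDRep F G} (x : V) : lin (0 : V ⟶ W) x = 0 := rfl

lemma lin_smul {V W : FDRep F G} (c : F) (f : V ⟶ W) (x : V) : lin (c • f) x = c • lin f x := rfl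

lemma lin_sum {V W : FDRep F G} {J : Type*} (s : Finset J) (f : J → (V ⟶ W)) (x : V) :
    lin (∑ j ∈ s, f j) x = ∑ j ∈ s, lin (f j) x :=
  map_sum (⟨⟨fun f => lin f x, lin_zero x⟩, fun f g => lin_add f g x⟩ : (V ⟶ W) →+ W) f s

lemma lin_whiskerLeft (U : FDRep F G) {V W : FDRep F G} (f : V ⟶ W) (x : U) (y : V) :
    lin (U ◁ f) (x ⊗ₜ[F] y) = x ⊗ₜ[F] lin f y := rfl

lemma lin_whiskerRight {V W : FDRep F G} (f : V ⟶ W) (U : FDRep F G) (x : V) (y : U) :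
    lin (f ▷ U) (x ⊗ₜ[F] y) = lin f x ⊗ₜ[F] y := rfl

lemma lin_tensor {V W V' W' : FDRep F G} (f : V ⟶ W) (g : V' ⟶ W') (x : V) (y : V') :
    lin (f ⊗ₘ g) (x ⊗ₜ[F] y) = lin f x ⊗ₜ[F] lin g y := rfl

lemma lin_associator (U V W : FDRep F G) (x : U) (y : V) (z : W) :
    lin (α_ U V W).hom ((x ⊗ₜ[F] y) ⊗ₜ[F] z) = x ⊗ₜ[F] (y ⊗ₜ[F] z) := rfl

lemma lin_associator_inv (U V W : FDRep F G) (x : U) (y : V) (z : W) :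
    lin (α_ U V W).inv (x ⊗ₜ[F] (y ⊗ₜ[F] z)) = (x ⊗ₜ[F] y) ⊗ₜ[F] z := rfl

lemma lin_leftUnitor (V : FDRep F G) (c : F) (x : V) :
    lin (λ_ V).hom ((show (𝟙_ (FDRep F G) : FDRep F G) from c) ⊗ₜ[F] x) = c • x := rfl

lemma lin_rightUnitor (V : FDRep F G) (c : F) (x : V) :
    lin (ρ_ V).hom (x ⊗ₜ[F] (show (𝟙_ (FDRep F G) : FDRep F G) from c)) = c • x := rfl

variable [Fintype G] [DecidableEq G]

variable (F) in
/-- The basis vector `δ_g` of the regular representation. -/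
def delta (g : G) : reg F G := (Pi.single g 1 : G → F)

lemma reg_hom_ext {W : FDRep F G} {f g : reg F G ⟶ W}
    (h : ∀ a, lin f (delta F a) = lin g (delta F a)) : f = g :=
  hom_ext' F G (LinearMap.pi_ext' fun a => LinearMap.ext_ring (h a))

lemma reg_tensor_hom_ext {W : FDRep F G} {f g : reg F G ⊗ reg F G ⟶ W}
    (h : ∀ a b, lin f (delta F a ⊗ₜ[F] delta F b) = lin g (delta F a ⊗ₜ[F] delta F b)) : f = g :=
  hom_ext' F G (TensorProduct.ext (LinearMap.pi_ext' fun a => LinearMap.ext_ring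
    (LinearMap.pi_ext' fun b => LinearMap.ext_ring (h a b))))

lemma lin_mul (a b : G) : lin μ[reg F G] (delta F a ⊗ₜ[F] delta F b) =
    if a = b then delta F a else 0 := by
  change (Pi.single a 1 : G → F) * Pi.single b 1 = _
  split_ifs with h
  · subst h
    rw [← Pi.single_mul, one_mul]
    rfl
  · ext k
    simp only [Pi.mul_apply, Pi.single_apply]
    change _ = (0 : F)
    split_ifs with h1 h2 <;> simp
    exact h (h1.symm.trans h2)

variable [CharZero F]

lemma lin_comul (a : G) : lin Δ[reg F G] (delta F a) =
    (Fintype.card G : F) • (delta F a ⊗ₜ[F] delta F a) := comulLin_single F G a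

lemma lin_counit (a : G) : lin ε[reg F G] (delta F a) =
    (show (𝟙_ (FDRep F G) : FDRep F G) from (Fintype.card G : F)⁻¹) := counitLin_single F G a

lemma card_ne_zero : (Fintype.card G : F) ≠ 0 := by simp

lemma lin_mul_counit (a b : G) : lin (μ[reg F G] ≫ ε[reg F G]) (delta F a ⊗ₜ[F] delta F b) =
    (show (𝟙_ (FDRep F G) : FDRep F G) from if a = b then (Fintype.card G : F)⁻¹ else (0 : F)) := by
  rw [lin_comp, lin_mul]
  split_ifs with h
  · exact lin_counit a
  · exact map_zero _

lemma reg_comul_mul_counit :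
    Δ[reg F G] ▷ reg F G ≫ (α_ _ _ _).hom ≫ reg F G ◁ (μ[reg F G] ≫ ε[reg F G]) ≫ (ρ_ _).hom =
      μ[reg F G] := by
  refine reg_tensor_hom_ext fun a b => ?_
  rw [lin_comp, lin_whiskerRight, lin_comul, ← TensorProduct.smul_tmul', map_smul, lin_comp,
    lin_associator, lin_comp, lin_whiskerLeft, lin_mul_counit, lin_rightUnitor, lin_mul, smul_smul]
  split_ifs with h
  · rw [mul_inv_cancel₀ card_ne_zero, one_smul]
  · rw [mul_zero, zero_smul]

lemma reg_mul_comul :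
    μ[reg F G] ≫ Δ[reg F G] = reg F G ◁ Δ[reg F G] ≫ (α_ _ _ _).inv ≫ μ[reg F G] ▷ reg F G := by
  refine reg_tensor_hom_ext fun a b => ?_
  rw [lin_comp, lin_comp, lin_comp, lin_whiskerLeft, lin_comul, TensorProduct.tmul_smul, map_smul,
    map_smul, lin_associator_inv, lin_whiskerRight, lin_mul]
  split_ifs with h
  · rw [lin_comul, h]
  · rw [map_zero, TensorProduct.zero_tmul, smul_zero]

lemma reg_comul_mul : Δ[reg F G] ≫ μ[reg F G] = (Fintype.card G : F) • 𝟙 (reg F G) := by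
  refine reg_hom_ext fun a => ?_
  rw [lin_comp, lin_comul, map_smul, lin_mul, if_pos rfl, lin_smul, lin_id]

variable (F) in
/-- Right translation by `k`, an automorphism of the regular representation. -/
def translation (k : G) : reg F G ⟶ reg F G :=
  mkHom F G (V := reg F G) (W := reg F G) (LinearMap.funLeft F F (fun h => h * k)) fun g => by
    refine LinearMap.ext fun f => funext fun h => ?_
    exact congrArg f (mul_assoc g⁻¹ h k).symm

lemma lin_translation (k a : G) : lin (translation F k) (delta F a) = delta F (a * k⁻¹) := by
  refine funext fun h => ?_
  change (Pi.single a 1 : G → F) (h * k) = (Pi.single (a * k⁻¹) 1 : G → F) h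
  simp only [Pi.single_apply, eq_mul_inv_iff_mul_eq]

lemma translation_one : translation F (1 : G) = 𝟙 _ := by
  refine reg_hom_ext fun a => ?_
  rw [lin_translation, inv_one, mul_one, lin_id]

lemma translation_comp (h k : G) :
    translation F h ≫ translation F k = translation F (k * h) := by
  refine reg_hom_ext fun a => ?_
  rw [lin_comp, lin_translation, lin_translation, lin_translation, mul_inv_rev, mul_assoc]

lemma translation_mul (k : G) :
    μ[reg F G] ≫ translation F k = (translation F k ⊗ₘ translation F k) ≫ μ[reg F G] := by
  refine reg_tensor_hom_ext fun a b => ?_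
  rw [lin_comp, lin_mul, lin_comp, lin_tensor, lin_translation, lin_translation, lin_mul]
  simp only [mul_left_inj]
  split_ifs with h
  · rw [lin_translation]
  · rw [map_zero]

lemma one_translation (k : G) : η[reg F G] ≫ translation F k = η[reg F G] := by
  apply hom_ext'
  exact LinearMap.ext fun x => rfl

lemma translation_comul (k : G) :
    translation F k ≫ Δ[reg F G] = Δ[reg F G] ≫ (translation F k ⊗ₘ translation F k) := by
  refine reg_hom_ext fun a => ?_
  rw [lin_comp, lin_translation, lin_comp, lin_comul, lin_comul, map_smul, lin_tensor,
    lin_translation]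

lemma translation_counit (k : G) : translation F k ≫ ε[reg F G] = ε[reg F G] := by
  refine reg_hom_ext fun a => ?_
  rw [lin_comp, lin_translation, lin_counit, lin_counit]

/-- A non-trivial translation moves every `δ_a` to a different, hence orthogonal, basis vector. -/
lemma comul_translation_mul_counit (k : G) (hk : k ≠ 1) :
    Δ[reg F G] ≫ reg F G ◁ translation F k ≫ μ[reg F G] ≫ ε[reg F G] = 0 := by
  refine reg_hom_ext fun a => ?_
  rw [lin_comp, lin_comul, map_smul, lin_comp, lin_whiskerLeft, lin_translation, lin_mul_counit,
    if_neg (by simpa using hk)]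
  exact smul_zero _

/-- On `δ_a ⊗ δ_b` only `k = b⁻¹ a` moves `δ_b` onto `δ_a`; translating the product back gives
`δ_b`. -/
lemma sum_translation :
    ∑ k : G, reg F G ◁ translation F k⁻¹ ≫ μ[reg F G] ≫ translation F k =
      (Fintype.card G : F) • (ε[reg F G] ▷ reg F G ≫ (λ_ _).hom) := by
  refine reg_tensor_hom_ext fun a b => ?_
  rw [lin_sum, lin_smul, lin_comp, lin_whiskerRight, lin_counit, lin_leftUnitor, smul_smul,
    mul_inv_cancel₀ card_ne_zero, one_smul, Finset.sum_eq_single (b⁻¹ * a)]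
  · rw [lin_comp, lin_whiskerLeft, lin_translation, lin_comp, lin_mul, if_pos (by group),
      lin_translation]
    congr 1
    group
  · intro k _ hk
    rw [lin_comp, lin_whiskerLeft, lin_translation, lin_comp, lin_mul, if_neg, map_zero]
    intro h
    apply hk
    rw [h]
    group
  · simp

/-- The group permutes the `δ_a` transitively, so an invariant functional has the same value on all
of them. -/
lemma exists_smul_counit (f : reg F G ⟶ 𝟙_ (FDRep F G)) : ∃ c : F, f = c • ε[reg F G] := by
  have h1 : ∀ a : G, lin f (delta F a) = lin f (delta F 1) := by
    intro a
    have := LinearMap.congr_fun (congrArg (fun t => t.hom.hom) (f.comm a)) (delta F 1)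
    have e : (reg F G).ρ a (delta F 1) = delta F a := by
      refine (rho_single F G a 1).trans ?_
      rw [mul_one]
      rfl
    rw [← e]
    exact this
  refine ⟨(Fintype.card G : F) * (show F from lin f (delta F 1)), reg_hom_ext fun a => ?_⟩
  rw [h1, lin_smul, lin_counit]
  change (show F from lin f (delta F 1)) = ((Fintype.card G : F) * _) * (Fintype.card G : F)⁻¹
  rw [mul_right_comm, mul_inv_cancel₀ card_ne_zero, one_mul]

lemma reg_counit_ne_zero : ε[reg F G] ≠ 0 := by
  intro h
  have h1 := lin_counit (F := F) (1 : G)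
  rw [h, lin_zero] at h1
  exact inv_ne_zero (card_ne_zero (F := F) (G := G)) h1.symm

/-- Endomorphisms of the algebra `reg F G` are right translations. -/
lemma exists_eq_translation (f : reg F G ⟶ reg F G)
    (hone : η[reg F G] ≫ f = η[reg F G]) (hmul : μ[reg F G] ≫ f = (f ⊗ₘ f) ≫ μ[reg F G]) :
    ∃ k : G, f = translation F k := by
  let φ : (G → F) →ₗ[F] (G → F) := lin f
  have φ_mul : ∀ x y : G → F, φ (x * y) = φ x * φ y := fun x y =>
    congrArg (fun t => lin t ((show reg F G from x) ⊗ₜ[F] (show reg F G from y))) hmul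
  have φ_one : φ 1 = 1 := by
    have := congrArg (fun t => lin t (show (𝟙_ (FDRep F G) : FDRep F G) from (1 : F))) hone
    have h1 : lin η[reg F G] (show (𝟙_ (FDRep F G) : FDRep F G) from (1 : F)) = (1 : G → F) :=
      map_one (algebraMap F (G → F))
    simp only [lin_comp] at this
    rw [h1] at this
    exact this
  have φ_rho : ∀ (g : G) (x : G → F), φ (rho F G g x) = rho F G g (φ x) := fun g x =>
    LinearMap.congr_fun (congrArg (fun t => t.hom.hom) (f.comm g)) x
  -- The map `x ↦ φ x 1` is a unital character of the function algebra, and the `δ_k` sum to `1`.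
  have h1 : ∃ k : G, φ (Pi.single k 1) 1 ≠ 0 := by
    by_contra! h
    have h2 : (1 : G → F) = ∑ k, Pi.single k 1 := by
      ext j
      simp
    have h3 := congrFun φ_one 1
    rw [h2, map_sum, Finset.sum_apply, Finset.sum_eq_zero fun k _ => h k, ← h2] at h3
    exact zero_ne_one h3
  obtain ⟨k, hk⟩ := h1
  -- From `x δ_k = x(k) δ_k` the character is evaluation at `k`. Equivariance then extends this from
  -- `1` to every group element.
  have h4 : ∀ x : G → F, φ x 1 = x k := by
    intro x
    have e : x * Pi.single k 1 = x k • Pi.single k 1 := by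
      ext j
      by_cases hj : j = k
      · subst hj; simp
      · simp [hj]
    have e2 := congrFun ((φ_mul x (Pi.single k 1)).symm.trans (congrArg φ e)) 1
    rw [map_smul, Pi.mul_apply, Pi.smul_apply, smul_eq_mul] at e2
    exact mul_right_cancel₀ hk e2
  refine ⟨k, hom_ext' F G (LinearMap.ext fun x => funext fun h => ?_)⟩
  have e3 : φ x (h⁻¹⁻¹ * 1) = (show G → F from x) (h⁻¹⁻¹ * k) :=
    (congrFun (φ_rho h⁻¹ x) 1).symm.trans (h4 _)
  rw [inv_inv, mul_one] at e3
  exact e3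

variable (F G) in
/-- Right translations as automorphisms of the regular algebra. -/
def translationAut : G →* Aut (Mon.mk (reg F G)) where
  toFun k :=
    { hom := { hom := translation F k
               isMonHom_hom := ⟨one_translation k, translation_mul k⟩ }
      inv := { hom := translation F k⁻¹
               isMonHom_hom := ⟨one_translation _, translation_mul _⟩ }
      hom_inv_id := Mon.Hom.ext (by
        change translation F k ≫ translation F k⁻¹ = 𝟙 _
        rw [translation_comp, inv_mul_cancel, translation_one])
      inv_hom_id := Mon.Hom.ext (by
        change translation F k⁻¹ ≫ translation F k = 𝟙 _
        rw [translation_comp, mul_inv_cancel, translation_one]) }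
  map_one' := Aut.ext (Mon.Hom.ext translation_one)
  map_mul' h k := Aut.ext (Mon.Hom.ext (translation_comp k h).symm)

variable (F G) in
/-- The automorphisms of the regular algebra are the right translations. -/
def translationEquiv : G ≃* Aut (Mon.mk (reg F G)) :=
  MulEquiv.ofBijective (translationAut F G)
    ⟨fun h k e => by
      have e1 : translation F h = translation F k := congrArg (fun t => t.hom.hom) e
      have e2 := congrArg (fun t => lin t (delta F 1)) e1
      simp only [lin_translation, one_mul] at e2
      have e3 := congrFun e2 h⁻¹
      simp only [delta, Pi.single_apply] at e3
      by_contra hne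
      rw [if_pos trivial, if_neg (by simpa using hne)] at e3
      exact one_ne_zero e3,
    fun x => by
      obtain ⟨k, hk⟩ := exists_eq_translation x.hom.hom (IsMonHom.one_hom x.hom.hom)
        (IsMonHom.mul_hom x.hom.hom)
      exact ⟨k, Aut.ext (Mon.Hom.ext hk.symm)⟩⟩

end RegularAlgebra
end

noncomputable section

/-! ### Transport of the algebra identities along a monoidal functor -/

section Transport

open Functor.LaxMonoidal Functor.OplaxMonoidal Functor.Monoidal

variable {A : Type*} [Category* A] [MonoidalCategory A] {B : Type*} [Category* B]
  [MonoidalCategory B] (P : A ⥤ B) [P.Monoidal] {X : A} {M : X ⊗ X ⟶ X} {D : X ⟶ X ⊗ X}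
  {e : X ⟶ 𝟙_ A}

/-- The transported structure maps carry the tensor constraints `μ` and `δ` of `P`, which are
mutually inverse and cancel in pairs; the following lemmas use the same mechanism. -/
lemma map_comul_mul_counit (h : D ▷ X ≫ (α_ _ _ _).hom ≫ X ◁ (M ≫ e) ≫ (ρ_ X).hom = M) :
    (P.map D ≫ δ P X X) ▷ P.obj X ≫ (α_ _ _ _).hom ≫
      P.obj X ◁ ((μ P X X ≫ P.map M) ≫ P.map e ≫ η P) ≫ (ρ_ (P.obj X)).hom =
      μ P X X ≫ P.map M := by
  conv_rhs => rw [← h]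
  simp only [Functor.map_comp, map_whiskerLeft, map_whiskerRight, map_associator, map_rightUnitor,
    comp_whiskerRight, whiskerLeft_comp, Category.assoc, μ_δ_assoc]

lemma map_mul_comul (h : M ≫ D = X ◁ D ≫ (α_ _ _ _).inv ≫ M ▷ X) :
    (μ P X X ≫ P.map M) ≫ P.map D ≫ δ P X X =
      P.obj X ◁ (P.map D ≫ δ P X X) ≫ (α_ _ _ _).inv ≫ (μ P X X ≫ P.map M) ▷ P.obj X := by
  have := congrArg (fun t => μ P X X ≫ P.map t ≫ δ P X X) h
  simp only [Functor.map_comp, Category.assoc] at this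
  rw [Category.assoc, this]
  simp only [map_whiskerLeft, map_whiskerRight, map_associator_inv,
    comp_whiskerRight, whiskerLeft_comp, Category.assoc, μ_δ_assoc, μ_δ, Category.comp_id]

lemma map_comul_mul :
    (P.map D ≫ δ P X X) ≫ μ P X X ≫ P.map M = P.map (D ≫ M) := by
  rw [Category.assoc, δ_μ_assoc, P.map_comp]

lemma comp_ε_comp_η {Y : B} (f : Y ⟶ 𝟙_ B) : (f ≫ ε P) ≫ η P = f := by
  rw [Category.assoc, ε_η, Category.comp_id]

lemma map_comul_tensor {f g : X ⟶ X} :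
    (P.map D ≫ δ P X X) ≫ (P.map f ⊗ₘ P.map g) = P.map (D ≫ (f ⊗ₘ g)) ≫ δ P X X := by
  rw [Functor.map_comp, map_tensor]
  simp only [Category.assoc, μ_δ, Category.comp_id]

lemma map_comul_whiskerLeft_mul_counit {f : X ⟶ X} :
    (P.map D ≫ δ P X X) ≫ P.obj X ◁ P.map f ≫ (μ P X X ≫ P.map M) ≫ P.map e ≫ η P =
      P.map (D ≫ X ◁ f ≫ M ≫ e) ≫ η P := by
  simp only [Functor.map_comp, map_whiskerLeft, Category.assoc]

lemma map_whiskerLeft_mul {f g : X ⟶ X} :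
    P.obj X ◁ P.map f ≫ (μ P X X ≫ P.map M) ≫ P.map g = μ P X X ≫ P.map (X ◁ f ≫ M ≫ g) := by
  simp only [Functor.map_comp, map_whiskerLeft, Category.assoc, μ_δ_assoc]

lemma map_counit_whiskerRight :
    (P.map e ≫ η P) ▷ P.obj X ≫ (λ_ (P.obj X)).hom = μ P X X ≫ P.map (e ▷ X ≫ (λ_ X).hom) := by
  simp only [Functor.map_comp, map_whiskerRight, map_leftUnitor, comp_whiskerRight,
    Category.assoc, μ_δ_assoc]

/-- A braided functor carries the symmetry of its source to its image; for `Rep G` this yields the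
trivial self-monodromy of `Γ`. -/
lemma braiding_comp_braiding_obj [SymmetricCategory A] [BraidedCategory B] (P : A ⥤ B)
    [P.Braided] (X : A) :
    (β_ (P.obj X) (P.obj X)).hom ≫ (β_ (P.obj X) (P.obj X)).hom = 𝟙 _ := by
  have h := congrArg P.map (SymmetricCategory.symmetry X X)
  rw [P.map_comp, P.map_id, Functor.map_braiding] at h
  have h2 := congrArg (fun t => μ P X X ≫ t ≫ δ P X X) h
  simpa only [Category.assoc, μ_δ_assoc, μ_δ, Category.comp_id, Category.id_comp] using h2

end Transport

open scoped ComonObj MonObj TensorProduct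

/-! ### `Γ` as a Galois object -/

section Regular

open RegularAlgebra

variable {F G : Type w} [Field F] [CharZero F] [Group G] [Fintype G] [DecidableEq G]
  {C : Type u} [Category.{v} C] [Preadditive C] [Linear F C] [MonoidalCategory C]
  [BraidedCategory C]
  (S : ObjectProperty C) [S.IsMonoidal]
  (Φ : FDRep F G ≌ S.FullSubcategory) [Φ.functor.Braided]

/-- The automorphism group of `Γ` is `G`. -/
def galoisGroupEquiv : G ≃* GaloisGroup (regularObj S Φ) :=
  (translationEquiv F G).trans
    (((Φ.fullyFaithfulFunctor.comp S.fullyFaithfulι).mapMon).autMulEquivOfFullyFaithful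
      (Mon.mk (reg F G)))

lemma galoisGroupEquiv_toHom (k : G) :
    (galoisGroupEquiv S Φ k).toHom = (Φ.functor ⋙ S.ι).map (translation F k) := rfl

instance : Fintype (GaloisGroup (regularObj S Φ)) :=
  Fintype.ofEquiv G (galoisGroupEquiv S Φ).toEquiv

lemma card_galoisGroup : Fintype.card (GaloisGroup (regularObj S Φ)) = Fintype.card G :=
  (Fintype.card_congr (galoisGroupEquiv S Φ).toEquiv).symm

lemma isGaloisObject_regularObj [Φ.functor.Additive] [Φ.functor.Linear F] :
    IsGaloisObject F (regularObj S Φ) where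
  symm := braiding_comp_braiding_obj (Φ.functor ⋙ S.ι) (reg F G)
  comul_mul_counit := map_comul_mul_counit _ reg_comul_mul_counit
  mul_comul := map_mul_comul _ reg_mul_comul
  comul_mul := by
    have h := congrArg (Φ.functor ⋙ S.ι).map (reg_comul_mul (F := F) (G := G))
    rw [Functor.map_smul, (Φ.functor ⋙ S.ι).map_id] at h
    rw [card_galoisGroup]
    exact (map_comul_mul (Φ.functor ⋙ S.ι)).trans h
  aut_comul g := by
    obtain ⟨k, rfl⟩ := (galoisGroupEquiv S Φ).surjective g
    rw [galoisGroupEquiv_toHom]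
    refine Eq.trans ?_ (map_comul_tensor (Φ.functor ⋙ S.ι)).symm
    rw [← translation_comul, Functor.map_comp, Category.assoc]
    rfl
  aut_counit g := by
    obtain ⟨k, rfl⟩ := (galoisGroupEquiv S Φ).surjective g
    rw [galoisGroupEquiv_toHom]
    have h := congrArg (Φ.functor ⋙ S.ι).map (translation_counit (F := F) k)
    rw [Functor.map_comp] at h
    exact (Category.assoc _ _ _).symm.trans
      (congrArg (· ≫ Functor.OplaxMonoidal.η (Φ.functor ⋙ S.ι)) h)
  comul_aut_mul_counit g hg := by
    obtain ⟨k, rfl⟩ := (galoisGroupEquiv S Φ).surjective g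
    have hk : k ≠ 1 := by
      rintro rfl
      exact hg (map_one _)
    rw [galoisGroupEquiv_toHom]
    refine (map_comul_whiskerLeft_mul_counit (Φ.functor ⋙ S.ι)).trans ?_
    rw [comul_translation_mul_counit k hk, Functor.map_zero, zero_comp]
    rfl
  sum_aut := by
    have h := congrArg (fun t => Functor.LaxMonoidal.μ (Φ.functor ⋙ S.ι) _ _ ≫
      (Φ.functor ⋙ S.ι).map t) (sum_translation (F := F) (G := G))
    simp only [Functor.map_smul, Functor.map_sum, Linear.comp_smul, Preadditive.comp_sum] at h
    rw [card_galoisGroup, ← Equiv.sum_comp (galoisGroupEquiv S Φ).toEquiv]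
    refine Eq.trans (Finset.sum_congr rfl fun k _ => ?_) (h.trans (congrArg _
      (map_counit_whiskerRight (Φ.functor ⋙ S.ι)).symm))
    refine Eq.trans ?_ (map_whiskerLeft_mul (Φ.functor ⋙ S.ι))
    have : ((galoisGroupEquiv S Φ) k)⁻¹ = galoisGroupEquiv S Φ k⁻¹ := (map_inv _ _).symm
    change _ ◁ (((galoisGroupEquiv S Φ) k)⁻¹).toHom ≫ _ ≫ ((galoisGroupEquiv S Φ) k).toHom = _
    rw [this, galoisGroupEquiv_toHom, galoisGroupEquiv_toHom]
    rfl
  exists_smul_counit f := by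
    -- Fullness of the functor, with `S` a full subcategory, brings `f` back to an invariant
    -- functional on the regular representation.
    obtain ⟨f', hf'⟩ := (Φ.functor ⋙ S.ι).map_surjective
      (f ≫ Functor.LaxMonoidal.ε (Φ.functor ⋙ S.ι))
    obtain ⟨c, hc⟩ := exists_smul_counit f'
    refine ⟨c, ?_⟩
    rw [hc, Functor.map_smul] at hf'
    have h := congrArg (· ≫ Functor.OplaxMonoidal.η (Φ.functor ⋙ S.ι)) hf'
    simp only [Linear.smul_comp] at h
    exact (comp_ε_comp_η (Φ.functor ⋙ S.ι) f).symm.trans h.symm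
  counit_ne_zero := by
    intro h
    apply reg_counit_ne_zero (F := F) (G := G)
    apply (Φ.functor ⋙ S.ι).map_injective
    have h1 : (Φ.functor ⋙ S.ι).map ε[reg F G] ≫
      Functor.OplaxMonoidal.η (Φ.functor ⋙ S.ι) = 0 := h
    have h2 := congrArg (· ≫ Functor.LaxMonoidal.ε (Φ.functor ⋙ S.ι)) h1
    simp only [Category.assoc, Functor.Monoidal.η_ε, zero_comp] at h2
    rw [Functor.map_zero]
    exact (Category.comp_id _).symm.trans h2

end Regular
end

theorem mainTheorem6
    {F G : Type w} [Field F] [IsAlgClosed F] [CharZero F]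
    [Group G] [Fintype G] [DecidableEq G]
    {C : Type u} [Category.{v} C] [Abelian C] [Linear F C]
    [MonoidalCategory C] [MonoidalPreadditive C] [MonoidalLinear F C]
    [BraidedCategory C] [RigidCategory C]
    (semisimple : IsSemisimpleCat C)
    (finiteDimensional_hom : ∀ X Y : C, FiniteDimensional F (X ⟶ Y))
    (end_unit : Module.finrank F (𝟙_ C ⟶ 𝟙_ C) = 1)
    (S : ObjectProperty C) [S.IsMonoidal]
    (Φ : FDRep F G ≌ S.FullSubcategory)
    [Φ.functor.Braided] [Φ.functor.Additive] [Φ.functor.Linear F] :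
    Nonempty (G ≃* GaloisGroup (regularObj S Φ)) ∧
    (IsStrictTensorCat C → IsStrictTensorCat (GaloisCat (regularObj S Φ))) ∧
    ∃ K : CrossedCategory (GaloisGroup (regularObj S Φ)) (GaloisCat (regularObj S Φ)),
      (∀ P, K.homogeneous P ↔ ∃ g, IsHomogeneousOfGrade (regularObj S Φ) P g) ∧
      (∀ P (hP : K.homogeneous P) g,
        K.grade P hP = g ↔ IsHomogeneousOfGrade (regularObj S Φ) P g) ∧
      IsGaloisAction (regularObj S Φ) K.action := by
  have H := isGaloisObject_regularObj S Φ
  have hreg := PreGalois.isRegularCat H semisimple.isRegularCat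
  have hss : IsSemisimpleCat (GaloisCat (regularObj S Φ)) :=
    hreg.isSemisimpleCat_karoubi (F := F) fun X =>
      PreGalois.finiteDimensional_hom finiteDimensional_hom X X
  exact ⟨⟨galoisGroupEquiv S Φ⟩, fun h => h.preGalois.karoubi,
    galoisCrossedCategory H hreg hss, fun _ => Iff.rfl,
    galoisCrossedCategory_grade_eq_iff H hreg hss, isGaloisAction_galoisTwist H⟩
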